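/- **Setting.** Let $k$ be a commutative ring, $T$ a $k$-algebra (associative, unital, not necessarily commutative), faithfully flat as a $k$-module, and $B\subset T$ a $k$-subalgebra. Write $\otimes=\otimes_k$, and write elements of tensor products formally as simple tensors. The centralizer $(T\otimes_B T)^B=\{t\in T\otimes_B T\mid bt=tb\ \ \forall b\in B\}$ is a $k$-algebra with unit $1\otimes 1$ and product $(x\otimes y)(a\otimes b)=ax\otimes yb$. A *$B$-torsor structure* on $T$ is a $k$-algebra map $\mu\colon T\to T\otimes (T\otimes_B T)^B$ such that, writing $\mu_0(x)=x^{(1)}\otimes x^{(2)}\otimes x^{(3)}\in T\otimes T\otimes_B T$ for the image of $\mu(x)$, for all $x\in T$ and $b\in B$, $$x^{(1)}x^{(2)}\otimes x^{(3)}=1\otimes x\in T\otimes_B T,\qquad x^{(1)}\otimes x^{(2)}x^{(3)}=x\otimes 1\in T\otimes T,\qquad \mu(b)=b\otimes 1\otimes 1,$$ $$\mu_0(x^{(1)})\otimes x^{(2)}\otimes x^{(3)}=x^{(1)}\otimes x^{(2)}\otimes\mu_0(x^{(3)})\in T\otimes T\otimes_B T\otimes T\otimes_B T.$$ Define $D\colon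 T\otimes_B T\to T\otimes T\otimes_B T$ by $D(x\otimes y)=xy^{(1)}\otimes y^{(2)}\otimes y^{(3)}$. For a $k$-bialgebra $H$ with comultiplication $\Delta$ and counit $\epsilon$, $T$ is an *$H$-Galois extension of $B$ under* a $k$-algebra map $\delta\colon T\to T\otimes H$ if $(\delta\otimes H)\delta=(T\otimes\Delta)\delta$ and $(T\otimes\epsilon)\delta(x)=x\otimes 1$ for all $x\in T$, if $B=\{x\in T\mid\delta(x)=x\otimes 1\}$, and if the Galois map $T\otimes_B T\to T\otimes H$, $x\otimes y\mapsto (x\otimes 1)\,\delta(y)$, is bijective. **Theorem.** Let $\mu$ be a $B$-torsor structure on $T$, where $T$ is faithfully flat over $k$, and assume that $T$ is faithfully flat as a right $B$-module. Then $$H:={}^D(T\otimes_B T)=\{m\in T\otimes_B T\mid D(m)=1\otimes m\}$$ is contained in $(T\otimes_B T)^B$ and is a $k$-subalgebra of it, it is flat as a $k$-module, and with this algebra structure it is a Hopf algebra over $k$, whose comultiplication and counit are given, for $x\otimes y\in H$, by $$\Delta(x\otimes y)=x\otimes y^{(1)}\otimes y^{(2)}\otimes y^{(3)},\qquad \epsilon(x\otimes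 y)=xy;$$ the first formula is read in $(T\otimes_B T)\otimes(T\otimes_B T)$ and the second in $T$. Moreover $\mu$ takes its values in $T\otimes H$, that is, it is induced by a $k$-algebra map $\delta\colon T\to T\otimes H$, and $T$ is an $H$-Galois extension of $B$ under $\delta$. -/

import Mathlib

open scoped TensorProduct

set_option linter.unusedSectionVars false

namespace NoncommTorsor

universe u v w

section Balanced

variable {k : Type v} {T : Type u} [CommRing k] [Ring T] [Algebra k T] (B : Subalgebra k T)
variable (M : Type w) [AddCommGroup M] [Module k M] [Module B M] [IsScalarTower k B M]

/-- The subgroup of `T ⊗[k] M` generated by the elements `x b ⊗ m - x ⊗ b m`, for `b` in `B`.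
The set of these elements is stable under left multiplication by `T`, so that the `T`-submodule
that it spans is just the additive subgroup that it generates (see `balancedRel_toAddSubgroup`). -/
def balancedRel : Submodule T (T ⊗[k] M) :=
  Submodule.span T {z | ∃ (x : T) (b : B) (m : M),
    z = (x * (b : T)) ⊗ₜ[k] m - x ⊗ₜ[k] (b • m)}

theorem balancedRel_toAddSubgroup :
    (balancedRel B M).toAddSubgroup = AddSubgroup.closure {z | ∃ (x : T) (b : B) (m : M),
      z = (x * (b : T)) ⊗ₜ[k] m - x ⊗ₜ[k] (b • m)} := by
  apply le_antisymm
  · intro z hz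
    change z ∈ balancedRel B M at hz
    unfold balancedRel at hz
    induction hz using Submodule.span_induction with
    | mem z hz => exact AddSubgroup.subset_closure hz
    | zero => exact zero_mem _
    | add _ _ _ _ h₁ h₂ => exact add_mem h₁ h₂
    | smul a z hz h =>
      clear hz
      induction h using AddSubgroup.closure_induction with
      | mem z hz =>
        obtain ⟨x, b, m, rfl⟩ := hz
        refine AddSubgroup.subset_closure ⟨a * x, b, m, ?_⟩
        simp [smul_sub, TensorProduct.smul_tmul', mul_assoc]
      | zero => simp
      | add _ _ _ _ h₁ h₂ => rw [smul_add]; exact add_mem h₁ h₂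
      | neg _ _ h => rw [smul_neg]; exact neg_mem h
  · rw [AddSubgroup.closure_le]
    exact Submodule.subset_span

/-- The tensor product `T ⊗_B M` over the (noncommutative) ring `B` of the right `B`-module `T`
with a left `B`-module `M`, with its left `T`-module structure. -/
abbrev BalTensor : Type (max u w) := (T ⊗[k] M) ⧸ balancedRel B M

variable {M}

/-- The class `x ⊗ m` in `T ⊗_B M`. -/
def tmulB (x : T) (m : M) : BalTensor B M := (balancedRel B M).mkQ (x ⊗ₜ[k] m)

theorem tmulB_mul (x : T) (b : B) (m : M) :
    tmulB B (x * (b : T)) m = tmulB B x (b • m) := by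
  unfold tmulB
  rw [← sub_eq_zero, ← map_sub, ← LinearMap.mem_ker, Submodule.ker_mkQ]
  exact Submodule.subset_span ⟨x, b, m, rfl⟩

theorem smul_tmulB (a x : T) (m : M) : a • tmulB B x m = tmulB B (a * x) m := by
  unfold tmulB
  rw [← map_smul, TensorProduct.smul_tmul', smul_eq_mul]

/-- The `k`-linear map `M → T ⊗_B M`, `m ↦ 1 ⊗ m`. -/
def oneTmulB : M →ₗ[k] BalTensor B M :=
  ((balancedRel B M).mkQ.restrictScalars k) ∘ₗ TensorProduct.mk k T M 1

@[simp] theorem oneTmulB_apply (m : M) : oneTmulB B m = tmulB B 1 m := rfl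

theorem oneTmulB_smul (b : B) (m : M) : oneTmulB B (b • m) = (b : T) • oneTmulB B m := by
  simp [smul_tmulB, ← tmulB_mul]

theorem balTensor_induction {p : BalTensor B M → Prop} (z : BalTensor B M)
    (zero : p 0) (tmul : ∀ x m, p (tmulB B x m)) (add : ∀ z w, p z → p w → p (z + w)) : p z := by
  obtain ⟨z, rfl⟩ := (balancedRel B M).mkQ_surjective z
  induction z with
  | zero => simpa using zero
  | tmul x m => exact tmul x m
  | add z w hz hw => rw [map_add]; exact add _ _ hz hw

variable {P : Type*} [AddCommGroup P] [Module k P] [Module T P] [IsScalarTower k T P]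

/-- The left `T`-linear map `T ⊗_B M → P`, `x ⊗ m ↦ x φ(m)`, induced by a left `B`-linear map
`φ : M → P` into a left `T`-module `P`. -/
def liftB (φ : M →ₗ[k] P) (hφ : ∀ (b : B) (m : M), φ (b • m) = (b : T) • φ m) :
    BalTensor B M →ₗ[T] P :=
  (balancedRel B M).liftQ
    (TensorProduct.AlgebraTensorModule.lift (LinearMap.toSpanSingleton T (M →ₗ[k] P) φ)) <| by
    unfold balancedRel
    rw [Submodule.span_le]
    rintro _ ⟨x, b, m, rfl⟩
    simp [hφ, mul_smul]

@[simp] theorem liftB_tmulB (φ : M →ₗ[k] P)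
    (hφ : ∀ (b : B) (m : M), φ (b • m) = (b : T) • φ m) (x : T) (m : M) :
    liftB B φ hφ (tmulB B x m) = x • φ m := by
  simp [liftB, tmulB]

variable {N : Type*} [AddCommGroup N] [Module k N] [Module B N] [IsScalarTower k B N]

/-- The map `T ⊗_B f : T ⊗_B M → T ⊗_B N` induced by a `B`-linear map `f : M → N`. -/
def lTensorB (f : M →ₗ[B] N) : BalTensor B M →ₗ[T] BalTensor B N :=
  liftB B (oneTmulB B ∘ₗ f.restrictScalars k) fun b m => by
    have h : f.restrictScalars k (b • m) = b • f.restrictScalars k m := map_smul f b m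
    rw [LinearMap.comp_apply, h, oneTmulB_smul, LinearMap.comp_apply]

theorem lTensorB_tmulB (f : M →ₗ[B] N) (x : T) (m : M) :
    lTensorB B f (tmulB B x m) = tmulB B x (f m) := by
  simp [lTensorB, smul_tmulB]

end Balanced

section FaithfullyFlat

variable {k : Type v} {T : Type u} [CommRing k] [Ring T] [Algebra k T]

/-- `T` is faithfully flat as a right `B`-module: a sequence `M → N → P` of left `B`-modules is
exact if and only if `T ⊗_B M → T ⊗_B N → T ⊗_B P` is exact. (A `B`-module carries exactly one
compatible `k`-module structure.) -/
def IsFaithfullyFlatRight (B : Subalgebra k T) : Prop :=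
  ∀ (M N P : Type u) [AddCommGroup M] [AddCommGroup N] [AddCommGroup P]
    [Module k M] [Module k N] [Module k P] [Module B M] [Module B N] [Module B P]
    [IsScalarTower k B M] [IsScalarTower k B N] [IsScalarTower k B P]
    (f : M →ₗ[B] N) (g : N →ₗ[B] P),
    Function.Exact f g ↔ Function.Exact (lTensorB B f) (lTensorB B g)

end FaithfullyFlat

section Torsor

variable {k : Type v} {T : Type u} [CommRing k] [Ring T] [Algebra k T] (B : Subalgebra k T)

/-- The multiplication `T ⊗_B T → T`, `x ⊗ y ↦ x y`. -/
def mulB : BalTensor B T →ₗ[T] T :=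
  liftB B LinearMap.id fun _ _ => rfl

@[simp] theorem mulB_tmulB (x y : T) : mulB B (tmulB B x y) = x * y := by simp [mulB]

/-- Right multiplication by `c` on `T ⊗_B T`: the map `x ⊗ y ↦ x ⊗ y c`. -/
def rightMulB (c : T) : BalTensor B T →ₗ[T] BalTensor B T :=
  liftB B (oneTmulB B ∘ₗ LinearMap.mulRight k c) fun b y => by
    have h : LinearMap.mulRight k c (b • y) = b • LinearMap.mulRight k c y := by
      simp [Subalgebra.smul_def, mul_assoc]
    rw [LinearMap.comp_apply, h, oneTmulB_smul, LinearMap.comp_apply]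

@[simp] theorem rightMulB_tmulB (c x y : T) :
    rightMulB B c (tmulB B x y) = tmulB B x (y * c) := by
  simp [rightMulB, smul_tmulB]

/-- The centralizer `(T ⊗_B T)^B` of `B` in the `B`-`B`-bimodule `T ⊗_B T`: the elements `t` with
`b t = t b` for all `b` in `B`. -/
def centralizer : Submodule k (BalTensor B T) where
  carrier := {t | ∀ b : B, (b : T) • t = rightMulB B (b : T) t}
  zero_mem' b := by simp
  add_mem' hs ht b := by rw [smul_add, map_add, hs b, ht b]
  smul_mem' c t ht b := by
    rw [smul_comm, ht b, LinearMap.map_smul_of_tower]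

theorem rightMulB_mul (c d : T) (t : BalTensor B T) :
    rightMulB B (c * d) t = rightMulB B d (rightMulB B c t) := by
  induction t using balTensor_induction with
  | zero => simp
  | tmul x y => simp [mul_assoc]
  | add _ _ h₁ h₂ => simp [h₁, h₂]

theorem rightMulB_one (t : BalTensor B T) : rightMulB B 1 t = t := by
  induction t using balTensor_induction with
  | zero => simp
  | tmul x y => simp
  | add _ _ h₁ h₂ => simp [h₁, h₂]

/-- The `k`-linear map `T → T ⊗_B T`, `c ↦ t c`. -/
def rightOrbitB (t : BalTensor B T) : T →ₗ[k] BalTensor B T where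
  toFun c := rightMulB B c t
  map_add' c d := by
    induction t using balTensor_induction with
    | zero => simp
    | tmul x y =>
      simp only [rightMulB_tmulB, mul_add]
      simp only [tmulB, TensorProduct.tmul_add, map_add]
    | add _ _ h₁ h₂ => simp only [map_add, h₁, h₂]; abel
  map_smul' r c := by
    induction t using balTensor_induction with
    | zero => simp
    | tmul x y =>
      simp only [rightMulB_tmulB, mul_smul_comm, RingHom.id_apply]
      simp only [tmulB, TensorProduct.tmul_smul, LinearMap.map_smul_of_tower]
    | add _ _ h₁ h₂ => simp only [map_add, h₁, h₂, smul_add]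

@[simp] theorem rightOrbitB_apply (t : BalTensor B T) (c : T) :
    rightOrbitB B t c = rightMulB B c t := rfl

/-- For `t` in the centralizer, the map `T ⊗_B T → T ⊗_B T`, `a ⊗ b ↦ a t b`. -/
def sandwich (t : centralizer B) : BalTensor B T →ₗ[T] BalTensor B T :=
  liftB B (rightOrbitB B (t : BalTensor B T)) fun b c => by
    rw [rightOrbitB_apply, Subalgebra.smul_def, smul_eq_mul, rightMulB_mul, ← t.2 b, map_smul,
      rightOrbitB_apply]

@[simp] theorem sandwich_tmulB (t : centralizer B) (a c : T) :
    sandwich B t (tmulB B a c) = a • rightMulB B c (t : BalTensor B T) := by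
  simp [sandwich]

theorem sandwich_rightMulB (t : centralizer B) (c : T) (s : BalTensor B T) :
    sandwich B t (rightMulB B c s) = rightMulB B c (sandwich B t s) := by
  induction s using balTensor_induction with
  | zero => simp
  | tmul x y => simp [rightMulB_mul]
  | add _ _ h₁ h₂ => simp [h₁, h₂]

theorem sandwich_mem (t s : centralizer B) : sandwich B t (s : BalTensor B T) ∈ centralizer B := by
  intro b
  rw [← sandwich_rightMulB, ← s.2 b, map_smul]

theorem one_mem_centralizer : tmulB B 1 1 ∈ centralizer B := by
  intro b
  rw [smul_tmulB, rightMulB_tmulB, mul_one, one_mul]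
  have h := tmulB_mul B (1 : T) b (1 : T)
  rwa [one_mul, Subalgebra.smul_def, smul_eq_mul, mul_one] at h

/-- The unit `1 ⊗ 1` of the centralizer. -/
instance : One (centralizer B) := ⟨⟨tmulB B 1 1, one_mem_centralizer B⟩⟩

/-- The product `(x ⊗ y)(a ⊗ b) = a x ⊗ y b` of the centralizer. -/
instance : Mul (centralizer B) := ⟨fun t s => ⟨sandwich B t s, sandwich_mem B t s⟩⟩

theorem coe_one : ((1 : centralizer B) : BalTensor B T) = tmulB B 1 1 := rfl

theorem coe_mul (t s : centralizer B) :
    ((t * s : centralizer B) : BalTensor B T) = sandwich B t (s : BalTensor B T) := rfl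

theorem sandwich_add (t t' : centralizer B) (s : BalTensor B T) :
    sandwich B (t + t') s = sandwich B t s + sandwich B t' s := by
  induction s using balTensor_induction with
  | zero => simp
  | tmul x y => simp
  | add _ _ h₁ h₂ => simp only [map_add, h₁, h₂]; abel

theorem sandwich_smul (r : k) (t : centralizer B) (s : BalTensor B T) :
    sandwich B (r • t) s = r • sandwich B t s := by
  induction s using balTensor_induction with
  | zero => simp
  | tmul x y =>
    rw [sandwich_tmulB, sandwich_tmulB, Submodule.coe_smul, LinearMap.map_smul_of_tower, smul_comm]
  | add _ _ h₁ h₂ => simp only [map_add, h₁, h₂, smul_add]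

theorem sandwich_mul (t s : centralizer B) (r : BalTensor B T) :
    sandwich B (t * s) r = sandwich B t (sandwich B s r) := by
  induction r using balTensor_induction with
  | zero => simp
  | tmul x y => simp [coe_mul, sandwich_rightMulB]
  | add _ _ h₁ h₂ => simp only [map_add, h₁, h₂]

theorem sandwich_one (r : BalTensor B T) : sandwich B 1 r = r := by
  induction r using balTensor_induction with
  | zero => simp
  | tmul x y => simp [coe_one, smul_tmulB]
  | add _ _ h₁ h₂ => simp only [map_add, h₁, h₂]

instance : Ring (centralizer B) where
  __ := (inferInstance : AddCommGroup (centralizer B))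
  mul_assoc t s r := Subtype.ext (sandwich_mul B t s r)
  one_mul t := Subtype.ext (sandwich_one B t)
  mul_one t := Subtype.ext (by simp [coe_mul, coe_one, rightMulB_one])
  left_distrib t s r := Subtype.ext (map_add (sandwich B t) (s : BalTensor B T) r)
  right_distrib t s r := Subtype.ext (sandwich_add B t s r)
  zero_mul t := Subtype.ext (by
    have h := sandwich_add B 0 0 (t : BalTensor B T)
    rw [add_zero] at h
    exact left_eq_add.mp h)
  mul_zero t := Subtype.ext (map_zero (sandwich B t))

instance : Algebra k (centralizer B) :=
  Algebra.ofModule (fun r t s => Subtype.ext (sandwich_smul B r t s))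
    (fun r t s => Subtype.ext (LinearMap.map_smul_of_tower (sandwich B t) r (s : BalTensor B T)))

variable {B}

/-- The map `μ₀ : T → T ⊗ T ⊗_B T`, `μ₀(x) = x⁽¹⁾ ⊗ x⁽²⁾ ⊗ x⁽³⁾`, induced by
`μ : T → T ⊗ (T ⊗_B T)^B`. -/
def muZero (μ : T →ₐ[k] T ⊗[k] centralizer B) : T →ₗ[k] T ⊗[k] BalTensor B T :=
  (centralizer B).subtype.lTensor T ∘ₗ μ.toLinearMap

theorem muZero_smul (μ : T →ₐ[k] T ⊗[k] centralizer B)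
    (hμ : ∀ b : B, μ (b : T) = (b : T) ⊗ₜ[k] 1) (b : B) (x : T) :
    muZero μ (b • x) = (b : T) • muZero μ x := by
  have key : ∀ z : T ⊗[k] centralizer B,
      (centralizer B).subtype.lTensor T (((b : T) ⊗ₜ[k] (1 : centralizer B)) * z) =
        (b : T) • (centralizer B).subtype.lTensor T z := by
    intro z
    induction z with
    | zero => simp
    | tmul a t => simp [TensorProduct.smul_tmul']
    | add _ _ h₁ h₂ => rw [mul_add, map_add, map_add, smul_add, h₁, h₂]
  simp only [muZero, LinearMap.comp_apply, AlgHom.toLinearMap_apply]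
  rw [Subalgebra.smul_def, smul_eq_mul, map_mul, hμ, key]

/-- The map `T ⊗_B μ₀ : T ⊗_B T → (T ⊗_B T) ⊗ (T ⊗_B T)`,
`x ⊗ y ↦ x ⊗ y⁽¹⁾ ⊗ y⁽²⁾ ⊗ y⁽³⁾`. -/
def tensorMu (μ : T →ₐ[k] T ⊗[k] centralizer B)
    (hμ : ∀ b : B, μ (b : T) = (b : T) ⊗ₜ[k] 1) :
    BalTensor B T →ₗ[T] BalTensor B T ⊗[k] BalTensor B T :=
  liftB B ((oneTmulB B).rTensor (BalTensor B T) ∘ₗ muZero μ) fun b x => by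
    have key : ∀ z : T ⊗[k] BalTensor B T,
        (oneTmulB B).rTensor (BalTensor B T) ((b : T) • z) =
          (b : T) • (oneTmulB B).rTensor (BalTensor B T) z := by
      intro z
      induction z with
      | zero => simp
      | tmul a t =>
        rw [TensorProduct.smul_tmul', LinearMap.rTensor_tmul, LinearMap.rTensor_tmul,
          TensorProduct.smul_tmul', ← oneTmulB_smul]
        rfl
      | add _ _ h₁ h₂ => rw [smul_add, map_add, map_add, smul_add, h₁, h₂]
    rw [LinearMap.comp_apply, muZero_smul μ hμ, key, LinearMap.comp_apply]

variable (B)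

/-- A `B`-torsor structure on `T`. -/
structure TorsorStructure where
  /-- The algebra map `μ : T → T ⊗ (T ⊗_B T)^B`. -/
  mu : T →ₐ[k] T ⊗[k] centralizer B
  /-- `x⁽¹⁾ x⁽²⁾ ⊗ x⁽³⁾ = 1 ⊗ x` in `T ⊗_B T`. -/
  mul_left : ∀ x : T,
    TensorProduct.lift (Algebra.lsmul k k (BalTensor B T)).toLinearMap (muZero mu x) = tmulB B 1 x
  /-- `x⁽¹⁾ ⊗ x⁽²⁾ x⁽³⁾ = x ⊗ 1` in `T ⊗ T`. -/
  mul_right : ∀ x : T,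
    ((mulB B).restrictScalars k).lTensor T (muZero mu x) = x ⊗ₜ[k] (1 : T)
  /-- `μ(b) = b ⊗ 1 ⊗ 1` for `b` in `B`. -/
  map_base : ∀ b : B, mu (b : T) = (b : T) ⊗ₜ[k] (1 : centralizer B)
  /-- `μ(x⁽¹⁾) ⊗ x⁽²⁾ ⊗ x⁽³⁾ = x⁽¹⁾ ⊗ x⁽²⁾ ⊗ μ(x⁽³⁾)` in `T ⊗ T ⊗_B T ⊗ T ⊗_B T`. -/
  coassoc : ∀ x : T,
    TensorProduct.assoc k T (BalTensor B T) (BalTensor B T)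
        ((muZero mu).rTensor (BalTensor B T) (muZero mu x)) =
      ((tensorMu mu map_base).restrictScalars k).lTensor T (muZero mu x)

variable {B}

/-- The map `D : T ⊗_B T → T ⊗ T ⊗_B T`, `x ⊗ y ↦ x y⁽¹⁾ ⊗ y⁽²⁾ ⊗ y⁽³⁾`. -/
def TorsorStructure.descentMap (τ : TorsorStructure B) :
    BalTensor B T →ₗ[T] T ⊗[k] BalTensor B T :=
  liftB B (muZero τ.mu) (muZero_smul τ.mu τ.map_base)

/-- The `k`-module `ᴰ(T ⊗_B T)` of all `m` in `T ⊗_B T` with `D(m) = 1 ⊗ m`. -/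
def TorsorStructure.descentInvariants (τ : TorsorStructure B) : Submodule k (BalTensor B T) :=
  LinearMap.eqLocus (τ.descentMap.restrictScalars k) (TensorProduct.mk k T (BalTensor B T) 1)

end Torsor

section HopfGalois

variable {k : Type v} {T : Type u} [CommRing k] [Ring T] [Algebra k T] (B : Subalgebra k T)

/-- `T` is an `H`-Galois extension of its subalgebra `B` under `δ : T → T ⊗ H`: the algebra map `δ`
makes `T` a right `H`-comodule algebra, the subalgebra of coinvariants is `B`, and the Galois map
`β : T ⊗_B T → T ⊗ H`, `β(x ⊗ y) = x δ(y)`, is bijective. -/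
structure IsHopfGalois {H : Type w} [Ring H] [Bialgebra k H] (δ : T →ₐ[k] T ⊗[k] H) : Prop where
  coassoc : ∀ x : T,
    TensorProduct.assoc k T H H (δ.toLinearMap.rTensor H (δ x)) =
      (Coalgebra.comul (R := k) (A := H)).lTensor T (δ x)
  counit : ∀ x : T, (Coalgebra.counit (R := k) (A := H)).lTensor T (δ x) = x ⊗ₜ[k] (1 : k)
  coinvariants : ∀ x : T, x ∈ B ↔ δ x = x ⊗ₜ[k] (1 : H)
  galois : ∃ β : BalTensor B T →ₗ[k] T ⊗[k] H,
    (∀ x y : T, β (tmulB B x y) = (x ⊗ₜ[k] (1 : H)) * δ y) ∧ Function.Bijective β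

end HopfGalois

end NoncommTorsor

namespace NoncommTorsor

universe u v w

/-! ### The Galois map and its use as a test for maps out of `H` -/

section GaloisMap

variable {k : Type v} {T : Type u} [CommRing k] [Ring T] [Algebra k T]

/-! Write S = T ⊗_B T. The map D is a descent datum on S for k → T, and H is the descended module,
so the heart of the matter is S ≅ T ⊗ H. By `mul_left`, the action T ⊗ S → S is a left inverse of D.
By `coassoc` and `mul_right`, T ⊗ D and T ⊗ (1 ⊗ -) agree on μ₀(x); as T is flat, μ₀(x) lies in T ⊗
H, which gives δ (`mu_mem_range`). Followed by T ⊗ H ⊂ T ⊗ S, the Galois map is D, so it is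
injective; since D(th) = t ⊗ h for h in H, it is also surjective (`galoisMap_bijective`).

Flatness of S over k comes from S ⊗ N = T ⊗_B (T ⊗ N), and passes to T ⊗ H and then to H. It makes H
⊗ H → S ⊗ S injective, so that Δ and the coassociativity of δ can be obtained inside tensor powers
of S. The counit has values in k because ε(h) ⊗ 1 = 1 ⊗ ε(h) in T ⊗ T.

Bijectivity of the Galois map then settles the algebra: T ⊗ H is spanned by the elements a δ(x), so
identities between linear maps on H, and multiplicativity of Δ and ε, need only be tested on δ(x)
(`linearMap_ext_of_galois`, `algHomOfGalois`). For the antipode, the Galois map produces an inverse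
of T ⊗ can, where can(g ⊗ h) = g h₁ ⊗ h₂; by faithful flatness can is bijective, and this forces an
antipode. Finally, coinvariants satisfy x ⊗ 1 = 1 ⊗ x in S, hence lie in B by faithfully flat
descent along B ⊂ T. -/

theorem smul_eq_tmul_one_mul {H : Type*} [Ring H] [Algebra k H] (a : T) (z : T ⊗[k] H) :
    a • z = (a ⊗ₜ[k] (1 : H)) * z := by
  induction z with
  | zero => simp
  | tmul x h => simp [TensorProduct.smul_tmul']
  | add _ _ h₁ h₂ => rw [smul_add, mul_add, h₁, h₂]

theorem one_tmul_mul_smul {H : Type*} [Ring H] [Algebra k H] (a : T) (h : H) (z : T ⊗[k] H) :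
    ((1 : T) ⊗ₜ[k] h) * (a • z) = a • (((1 : T) ⊗ₜ[k] h) * z) := by
  rw [smul_eq_tmul_one_mul, smul_eq_tmul_one_mul, ← mul_assoc, ← mul_assoc]
  simp

theorem smul_mul_tensor {H : Type*} [Ring H] [Algebra k H] (a : T) (z w : T ⊗[k] H) :
    (a • z) * w = a • (z * w) := by
  rw [smul_eq_tmul_one_mul, smul_eq_tmul_one_mul, mul_assoc]

theorem lTensor_smul {M N : Type*} [AddCommGroup M] [Module k M] [AddCommGroup N] [Module k N]
    (f : M →ₗ[k] N) (a : T) (z : T ⊗[k] M) : f.lTensor T (a • z) = a • f.lTensor T z :=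
  map_smul (f.baseChange T) a z

theorem one_tmul_injective [Module.FaithfullyFlat k T] {M : Type*} [AddCommGroup M] [Module k M] :
    Function.Injective fun m : M => (1 : T) ⊗ₜ[k] m :=
  (injective_iff_map_eq_zero (TensorProduct.mk k T M 1)).2 fun m hm =>
    (Module.FaithfullyFlat.one_tmul_eq_zero_iff (A := T) k M m).1 hm

variable (B : Subalgebra k T) {H : Type w} [Ring H] [Algebra k H]
  (δ : T →ₐ[k] T ⊗[k] H)

/-- The Galois map `T ⊗_B T → T ⊗ H`, `x ⊗ y ↦ x δ(y)`. -/
def galoisMap (hδ : ∀ b : B, δ (b : T) = (b : T) ⊗ₜ[k] (1 : H)) :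
    BalTensor B T →ₗ[T] T ⊗[k] H :=
  liftB B δ.toLinearMap fun b x => by
    rw [Subalgebra.smul_def, smul_eq_mul, AlgHom.toLinearMap_apply, map_mul, hδ,
      ← smul_eq_tmul_one_mul, AlgHom.toLinearMap_apply]

variable {δ} {hδ : ∀ b : B, δ (b : T) = (b : T) ⊗ₜ[k] (1 : H)}

@[simp] theorem galoisMap_tmulB (x y : T) : galoisMap B δ hδ (tmulB B x y) = x • δ y := by
  simp [galoisMap]

variable {B}

theorem galois_induction (hβ : Function.Surjective (galoisMap B δ hδ)) {p : T ⊗[k] H → Prop}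
    (w : T ⊗[k] H) (zero : p 0) (smul : ∀ a x : T, p (a • δ x))
    (add : ∀ z w, p z → p w → p (z + w)) : p w := by
  obtain ⟨s, rfl⟩ := hβ w
  induction s using balTensor_induction with
  | zero => simpa using zero
  | tmul x y => simpa using smul x y
  | add _ _ h₁ h₂ => rw [map_add]; exact add _ _ h₁ h₂

/-- The maps T ⊗ f and T ⊗ g are left T-linear and T ⊗ H is spanned by the elements a δ(x); faithful
flatness then lets f and g be compared after applying 1 ⊗ -. -/
theorem linearMap_ext_of_galois [Module.FaithfullyFlat k T]
    (hβ : Function.Surjective (galoisMap B δ hδ)) {M : Type*} [AddCommGroup M] [Module k M]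
    {f g : H →ₗ[k] M} (h : ∀ x, f.lTensor T (δ x) = g.lTensor T (δ x)) : f = g := by
  have key : ∀ w : T ⊗[k] H, f.lTensor T w = g.lTensor T w := fun w => by
    induction w using galois_induction hβ with
    | zero => simp
    | smul a x => rw [lTensor_smul, lTensor_smul, h]
    | add _ _ h₁ h₂ => rw [map_add, map_add, h₁, h₂]
  ext a
  apply one_tmul_injective (k := k) (T := T)
  simpa using key (1 ⊗ₜ a)

/-- A linear map `f : H → M` for which `(T ⊗ f) δ` is an algebra map is an algebra map. -/
def algHomOfGalois [Module.FaithfullyFlat k T]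
    (hβ : Function.Surjective (galoisMap B δ hδ)) {M : Type*} [Ring M] [Algebra k M]
    (f : H →ₗ[k] M) (φ : T →ₐ[k] T ⊗[k] M) (h : ∀ x, f.lTensor T (δ x) = φ x) : H →ₐ[k] M :=
  AlgHom.ofLinearMap f
    (by
      apply one_tmul_injective (k := k) (T := T)
      simpa [Algebra.TensorProduct.one_def] using h 1)
    (fun a b => by
      -- Multiplicativity is reached in two stages: first for a right factor δ(c), where the left
      -- factor may be taken to be a δ(x); then for a left factor 1 ⊗ a, which commutes with T ⊗ 1.
      have h₁ : ∀ w c, f.lTensor T (w * δ c) = f.lTensor T w * φ c := fun w c => by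
        induction w using galois_induction hβ with
        | zero => simp
        | smul a x =>
          rw [smul_mul_tensor, ← map_mul, lTensor_smul, lTensor_smul, h, h, map_mul,
            smul_mul_tensor]
        | add _ _ h₁ h₂ => rw [map_add, add_mul, map_add, add_mul, h₁, h₂]
      have h₂ : ∀ w, f.lTensor T (((1 : T) ⊗ₜ[k] a) * w) =
          ((1 : T) ⊗ₜ[k] f a) * f.lTensor T w := fun w => by
        induction w using galois_induction hβ with
        | zero => simp
        | smul a x =>
          rw [one_tmul_mul_smul, lTensor_smul, lTensor_smul, one_tmul_mul_smul, h₁, h,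
            LinearMap.lTensor_tmul]
        | add _ _ h₁ h₂ => rw [map_add, mul_add, map_add, mul_add, h₁, h₂]
      apply one_tmul_injective (k := k) (T := T)
      simpa using h₂ (1 ⊗ₜ b))

end GaloisMap

/-! ### Balanced maps that are not T-linear -/

section Lift

variable {k : Type v} {T : Type u} [CommRing k] [Ring T] [Algebra k T] (B : Subalgebra k T)
variable {M : Type w} [AddCommGroup M] [Module k M] [Module B M] [IsScalarTower k B M]
variable {P : Type*} [AddCommGroup P] [Module k P]

/-- The `k`-linear map `T ⊗_B M → P` induced by a `B`-balanced bilinear map. -/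
def liftBalanced (f : T →ₗ[k] M →ₗ[k] P)
    (hf : ∀ (x : T) (b : B) (m : M), f (x * (b : T)) m = f x (b • m)) :
    BalTensor B M →ₗ[k] P :=
  ((balancedRel B M).restrictScalars k).liftQ (TensorProduct.lift f) (by
    intro z hz
    replace hz : z ∈ (balancedRel B M).toAddSubgroup := hz
    rw [balancedRel_toAddSubgroup] at hz
    induction hz using AddSubgroup.closure_induction with
    | mem z hz => obtain ⟨x, b, m, rfl⟩ := hz; simp [hf]
    | zero => exact zero_mem _
    | add _ _ _ _ h₁ h₂ => exact add_mem h₁ h₂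
    | neg _ _ h => exact neg_mem h) ∘ₗ
  (Submodule.Quotient.restrictScalarsEquiv k (balancedRel B M)).symm.toLinearMap

@[simp] theorem liftBalanced_tmulB (f : T →ₗ[k] M →ₗ[k] P)
    (hf : ∀ (x : T) (b : B) (m : M), f (x * (b : T)) m = f x (b • m)) (x : T) (m : M) :
    liftBalanced B f hf (tmulB B x m) = f x m := by
  change TensorProduct.lift f (x ⊗ₜ m) = _
  simp

end Lift

/-! ### Antipode from the canonical map of a bialgebra -/

section CanonicalMap

variable (k : Type v) [CommRing k] (H : Type w) [Ring H] [Bialgebra k H]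

open Coalgebra

/-- The canonical map `H ⊗ H → H ⊗ H`, `g ⊗ h ↦ g h₁ ⊗ h₂`. -/
def canonicalMap : H ⊗[k] H →ₗ[k] H ⊗[k] H :=
  TensorProduct.lift ((LinearMap.mul k (H ⊗[k] H)).compl₁₂
    (Algebra.TensorProduct.includeLeft : H →ₐ[k] H ⊗[k] H).toLinearMap comul)

variable {k H}

theorem canonicalMap_tmul (g h : H) :
    canonicalMap k H (g ⊗ₜ[k] h) = (g ⊗ₜ[k] (1 : H)) * comul h := by
  simp [canonicalMap]

theorem canonicalMap_mul (g : H) (z : H ⊗[k] H) :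
    canonicalMap k H ((g ⊗ₜ[k] (1 : H)) * z) = (g ⊗ₜ[k] (1 : H)) * canonicalMap k H z := by
  induction z with
  | zero => simp
  | tmul a b =>
    rw [Algebra.TensorProduct.tmul_mul_tmul, one_mul, canonicalMap_tmul, canonicalMap_tmul,
      ← mul_assoc, Algebra.TensorProduct.tmul_mul_tmul, one_mul]
  | add _ _ h₁ h₂ => rw [mul_add, map_add, map_add, mul_add, h₁, h₂]

/-- The map `H ⊗ ε : H ⊗ H → H`. -/
def counitRight : H ⊗[k] H →ₗ[k] H :=
  (TensorProduct.rid k H).toLinearMap ∘ₗ (counit (R := k) (A := H)).lTensor H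

theorem counitRight_tmul (g h : H) :
    counitRight (k := k) (g ⊗ₜ[k] h) = counit (R := k) h • g := by
  simp [counitRight]

theorem counitRight_mul (g : H) (z : H ⊗[k] H) :
    counitRight ((g ⊗ₜ[k] (1 : H)) * z) = g * counitRight z := by
  induction z with
  | zero => simp
  | tmul a b => simp [counitRight_tmul]
  | add _ _ h₁ h₂ => rw [mul_add, map_add, map_add, mul_add, h₁, h₂]

theorem counitRight_comul (h : H) : counitRight (k := k) (comul h) = h := by
  simp [counitRight]

theorem counitRight_canonicalMap (z : H ⊗[k] H) :
    counitRight (canonicalMap k H z) = LinearMap.mul' k H z := by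
  induction z with
  | zero => simp
  | tmul g h => rw [canonicalMap_tmul, counitRight_mul, counitRight_comul, LinearMap.mul'_apply]
  | add _ _ h₁ h₂ => rw [map_add, map_add, map_add, h₁, h₂]

/-- This is right H-colinearity of can for the coaction H ⊗ Δ, a consequence of coassociativity. It
lets the inverse of can be moved past Δ. -/
theorem canonicalMap_colinear (z : H ⊗[k] H) :
    (canonicalMap k H).rTensor H ((TensorProduct.assoc k H H H).symm
        ((comul (R := k) (A := H)).lTensor H z)) =
      (TensorProduct.assoc k H H H).symm
        ((comul (R := k) (A := H)).lTensor H (canonicalMap k H z)) := by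
  have key₁ : ∀ (g : H) (w : H ⊗[k] H),
      (canonicalMap k H).rTensor H ((TensorProduct.assoc k H H H).symm (g ⊗ₜ w)) =
        ((g ⊗ₜ[k] (1 : H)) ⊗ₜ[k] (1 : H)) * (comul (R := k) (A := H)).rTensor H w := by
    intro g w
    induction w with
    | zero => simp
    | tmul a b => simp [canonicalMap_tmul]
    | add _ _ h₁ h₂ => rw [TensorProduct.tmul_add, map_add, map_add, map_add, mul_add, h₁, h₂]
  have key₂ : ∀ (g : H) (w : H ⊗[k] H),
      (TensorProduct.assoc k H H H).symm
        ((comul (R := k) (A := H)).lTensor H ((g ⊗ₜ[k] (1 : H)) * w)) =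
      ((g ⊗ₜ[k] (1 : H)) ⊗ₜ[k] (1 : H)) * (TensorProduct.assoc k H H H).symm
        ((comul (R := k) (A := H)).lTensor H w) := by
    intro g w
    induction w with
    | zero => simp
    | tmul a b =>
      rw [Algebra.TensorProduct.tmul_mul_tmul, one_mul, LinearMap.lTensor_tmul,
        LinearMap.lTensor_tmul]
      generalize comul (R := k) b = c
      induction c with
      | zero => simp
      | tmul p q => simp
      | add _ _ h₁ h₂ => simp only [TensorProduct.tmul_add, map_add, mul_add, h₁, h₂]
    | add _ _ h₁ h₂ => rw [mul_add, map_add, map_add, map_add, map_add, mul_add, h₁, h₂]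
  induction z with
  | zero => simp
  | tmul g h =>
    rw [LinearMap.lTensor_tmul, key₁, canonicalMap_tmul, key₂, Coalgebra.coassoc_symm_apply]
  | add _ _ h₁ h₂ => simp only [map_add, h₁, h₂]

/-- A bialgebra with bijective canonical map has an antipode. -/
theorem exists_antipode_of_bijective (hc : Function.Bijective (canonicalMap k H)) :
    ∃ S : H →ₗ[k] H,
      LinearMap.mul' k H ∘ₗ S.rTensor H ∘ₗ comul = Algebra.linearMap k H ∘ₗ counit ∧
      LinearMap.mul' k H ∘ₗ S.lTensor H ∘ₗ comul = Algebra.linearMap k H ∘ₗ counit := by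
  let e := LinearEquiv.ofBijective (canonicalMap k H) hc
  have he : ∀ z, e z = canonicalMap k H z := fun _ => rfl
  have hsymm : ∀ z, canonicalMap k H (e.symm z) = z := fun z => e.apply_symm_apply z
  have hmul : ∀ (g : H) (z : H ⊗[k] H),
      e.symm ((g ⊗ₜ[k] (1 : H)) * z) = (g ⊗ₜ[k] (1 : H)) * e.symm z := fun g z => by
    rw [LinearEquiv.symm_apply_eq, he, canonicalMap_mul, hsymm]
  let α : H →ₗ[k] H ⊗[k] H := e.symm.toLinearMap ∘ₗ TensorProduct.mk k H H 1
  have hα : ∀ h, canonicalMap k H (α h) = 1 ⊗ₜ h := fun h => hsymm _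
  -- The antipode is S(h) = (H ⊗ ε) can⁻¹(1 ⊗ h). For the left identity, colinearity gives (S ⊗ H)Δ
  -- = α, and multiplication equals (H ⊗ ε) can.
  refine ⟨counitRight ∘ₗ α, ?_, ?_⟩
  · have colin : ∀ h, (TensorProduct.assoc k H H H).symm
        ((comul (R := k) (A := H)).lTensor H (α h)) = α.rTensor H (comul h) := by
      intro h
      apply (LinearEquiv.rTensor H e).injective
      change (canonicalMap k H).rTensor H _ = (canonicalMap k H).rTensor H _
      rw [canonicalMap_colinear, hα, ← LinearMap.comp_apply, ← LinearMap.rTensor_comp,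
        show canonicalMap k H ∘ₗ α = TensorProduct.mk k H H 1 from LinearMap.ext hα,
        LinearMap.lTensor_tmul]
      generalize comul (R := k) h = c
      induction c with
      | zero => simp
      | tmul p q => simp
      | add _ _ h₁ h₂ => simp only [TensorProduct.tmul_add, map_add, h₁, h₂]
    have hR : ∀ z : H ⊗[k] H, (counitRight (k := k) (H := H)).rTensor H
        ((TensorProduct.assoc k H H H).symm ((comul (R := k) (A := H)).lTensor H z)) = z := by
      intro z
      induction z with
      | zero => simp
      | tmul g h =>
        have : ∀ w : H ⊗[k] H, (counitRight (k := k) (H := H)).rTensor H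
            ((TensorProduct.assoc k H H H).symm (g ⊗ₜ w)) =
              g ⊗ₜ TensorProduct.lid k H ((counit (R := k) (A := H)).rTensor H w) := by
          intro w
          induction w with
          | zero => simp
          | tmul a b => simp [counitRight_tmul, TensorProduct.smul_tmul]
          | add _ _ h₁ h₂ => simp only [TensorProduct.tmul_add, map_add, h₁, h₂]
        rw [LinearMap.lTensor_tmul, this]
        simp
      | add _ _ h₁ h₂ => simp only [map_add, h₁, h₂]
    ext h
    rw [LinearMap.comp_apply, LinearMap.comp_apply, LinearMap.rTensor_comp, LinearMap.comp_apply,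
      ← colin, hR, ← counitRight_canonicalMap, hα, counitRight_tmul, LinearMap.comp_apply,
      Algebra.linearMap_apply, Algebra.algebraMap_eq_smul_one]
  -- Left H-linearity of can⁻¹ gives g S(h) = (H ⊗ ε) can⁻¹(g ⊗ h), to be evaluated at Δ(h) = can(1
  -- ⊗ h).
  · have hl : ∀ z : H ⊗[k] H, LinearMap.mul' k H ((counitRight ∘ₗ α).lTensor H z) =
        counitRight (e.symm z) := by
      intro z
      induction z with
      | zero => simp
      | tmul g h =>
        have : g ⊗ₜ[k] h = (g ⊗ₜ[k] (1 : H)) * ((1 : H) ⊗ₜ[k] h) := by simp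
        rw [this, hmul, counitRight_mul, ← this]
        simp [α]
      | add _ _ h₁ h₂ => simp only [map_add, h₁, h₂]
    ext h
    have h₁ : comul (R := k) h = e (1 ⊗ₜ h) := by
      rw [he, canonicalMap_tmul, ← Algebra.TensorProduct.one_def, one_mul]
    rw [LinearMap.comp_apply, LinearMap.comp_apply, hl, h₁, LinearEquiv.symm_apply_apply,
      counitRight_tmul, LinearMap.comp_apply, Algebra.linearMap_apply,
      Algebra.algebraMap_eq_smul_one]

end CanonicalMap

/-! ### Bijectivity of the canonical map from that of the Galois map -/

section Antipode

variable {k : Type v} {T : Type u} [CommRing k] [Ring T] [Algebra k T] {B : Subalgebra k T}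
  {H : Type w} [Ring H] [Bialgebra k H] {δ : T →ₐ[k] T ⊗[k] H}
  {hδ : ∀ b : B, δ (b : T) = (b : T) ⊗ₜ[k] (1 : H)}

open Coalgebra

/-- If a bialgebra coacts on a faithfully flat algebra with bijective Galois map, then its
canonical map is bijective. -/
theorem canonicalMap_bijective [Module.FaithfullyFlat k T]
    (hβ : Function.Bijective (galoisMap B δ hδ))
    (hco : ∀ x : T, TensorProduct.assoc k T H H (δ.toLinearMap.rTensor H (δ x)) =
      (comul (R := k) (A := H)).lTensor T (δ x)) :
    Function.Bijective (canonicalMap k H) := by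
  rw [← Module.FaithfullyFlat.lTensor_bijective_iff_bijective k T]
  let A₁ : T →ₐ[k] T ⊗[k] (H ⊗[k] H) := (Algebra.TensorProduct.map (AlgHom.id k T)
    (Algebra.TensorProduct.includeLeft : H →ₐ[k] H ⊗[k] H)).comp δ
  let A₂ : T →ₐ[k] T ⊗[k] (H ⊗[k] H) := (Algebra.TensorProduct.map (AlgHom.id k T)
    (Algebra.TensorProduct.includeRight : H →ₐ[k] H ⊗[k] H)).comp δ
  have hA₁ : ∀ b : B, A₁ b = (b : T) ⊗ₜ 1 := fun b => by
    simp [A₁, hδ, Algebra.TensorProduct.one_def]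
  have hA₂ : ∀ b : B, A₂ b = (b : T) ⊗ₜ 1 := fun b => by
    simp [A₂, hδ, Algebra.TensorProduct.one_def]
  -- Two copies of δ, with values in the first and in the second factor H, are multiplied: x ⊗ y ↦
  -- x₀y₀ ⊗ x₁ ⊗ y₁. This is linear over T only through `A₁`, so `liftB` does not apply.
  let Θ : BalTensor B T →ₗ[k] T ⊗[k] (H ⊗[k] H) :=
    liftBalanced B ((LinearMap.mul k (T ⊗[k] (H ⊗[k] H))).compl₁₂ A₁.toLinearMap A₂.toLinearMap)
      fun x b m => by
        simp [hA₁, hA₂, Subalgebra.smul_def, mul_assoc]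
  have hΘ : ∀ x y, Θ (tmulB B x y) = A₁ x * A₂ y := fun x y => by simp [Θ]
  have hΘs : ∀ a s, Θ (a • s) = A₁ a * Θ s := fun a s => by
    induction s using balTensor_induction with
    | zero => simp
    | tmul x y => rw [smul_tmulB, hΘ, hΘ, map_mul, mul_assoc]
    | add _ _ h₁ h₂ => rw [smul_add, map_add, map_add, mul_add, h₁, h₂]
  let e := LinearEquiv.ofBijective (galoisMap B δ hδ) hβ
  have hβe : ∀ w, galoisMap B δ hδ (e.symm w) = w := fun w => e.apply_symm_apply w
  let F := (canonicalMap k H).lTensor T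
  have hF : ∀ (t : T) (g : H) (z : T ⊗[k] (H ⊗[k] H)),
      F ((t ⊗ₜ (g ⊗ₜ 1)) * z) = (t ⊗ₜ (g ⊗ₜ 1)) * F z := fun t g z => by
    induction z with
    | zero => simp
    | tmul a b => simp [F, canonicalMap_mul]
    | add _ _ h₁ h₂ => rw [mul_add, map_add, map_add, mul_add, h₁, h₂]
  have hFA : ∀ (a : T) (z : T ⊗[k] (H ⊗[k] H)), F (A₁ a * z) = A₁ a * F z := fun a z => by
    simp only [A₁, AlgHom.comp_apply]
    generalize δ a = w
    induction w with
    | zero => simp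
    | tmul t g => simpa using hF t g z
    | add _ _ h₁ h₂ => simp only [map_add, add_mul, h₁, h₂]
  let W : T ⊗[k] H →ₗ[k] T ⊗[k] (H ⊗[k] H) :=
    (TensorProduct.assoc k T H H).toLinearMap ∘ₗ δ.toLinearMap.rTensor H
  have hW : ∀ (t : T) (h : H), W (t ⊗ₜ h) = A₁ t * (1 ⊗ₜ (1 ⊗ₜ h)) := fun t h => by
    simp only [W, A₁, AlgHom.comp_apply, LinearMap.comp_apply, LinearMap.rTensor_tmul,
      AlgHom.toLinearMap_apply, LinearEquiv.coe_coe]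
    generalize δ t = w
    induction w with
    | zero => simp
    | tmul t g => simp
    | add _ _ h₁ h₂ => simp only [map_add, add_mul, TensorProduct.add_tmul, h₁, h₂]
  have hWs : ∀ (a : T) (w : T ⊗[k] H), W (a • w) = A₁ a * W w := fun a w => by
    induction w with
    | zero => simp
    | tmul t h => rw [TensorProduct.smul_tmul', hW, hW, smul_eq_mul, map_mul, mul_assoc]
    | add _ _ h₁ h₂ => rw [smul_add, map_add, map_add, mul_add, h₁, h₂]
  have hWδ : ∀ x, W (δ x) = (comul (R := k) (A := H)).lTensor T (δ x) := hco
  have hFA₂ : ∀ x, F (A₂ x) = W (δ x) := fun x => by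
    rw [hWδ]
    simp only [A₂, AlgHom.comp_apply, F]
    generalize δ x = w
    induction w with
    | zero => simp
    | tmul t g => simp [canonicalMap_tmul, ← Algebra.TensorProduct.one_def]
    | add _ _ h₁ h₂ => simp only [map_add, h₁, h₂]
  -- With F = T ⊗ can and W = δ ⊗ H, this square determines the inverse of F on the image of W: it
  -- must send W(w) to Θ(β⁻¹(w)).
  have hFΘ : ∀ s, F (Θ s) = W (galoisMap B δ hδ s) := fun s => by
    induction s using balTensor_induction with
    | zero => simp
    | tmul x y => rw [hΘ, hFA, hFA₂, galoisMap_tmulB, hWs]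
    | add _ _ h₁ h₂ => simp only [map_add, h₁, h₂]
  let θ : H →ₗ[k] T ⊗[k] (H ⊗[k] H) := Θ ∘ₗ e.symm.toLinearMap.restrictScalars k ∘ₗ
    TensorProduct.mk k T H 1
  have hθ : ∀ h, θ h = Θ (e.symm (1 ⊗ₜ h)) := fun h => rfl
  have hFθ : ∀ h, F (θ h) = 1 ⊗ₜ (1 ⊗ₜ h) := fun h => by
    rw [hθ, hFΘ, hβe, hW, map_one, one_mul]
  -- The candidate inverse of F: its value θ(h) at 1 ⊗ 1 ⊗ h is forced by W(1 ⊗ h) = 1 ⊗ 1 ⊗ h, and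
  -- it is extended by left multiplication by t ⊗ g ⊗ 1.
  let Ψ : T ⊗[k] (H ⊗[k] H) →ₗ[k] T ⊗[k] (H ⊗[k] H) :=
    TensorProduct.lift ((LinearMap.mul k (T ⊗[k] (H ⊗[k] H))).compl₁₂
      ((Algebra.TensorProduct.includeLeft : H →ₐ[k] H ⊗[k] H).toLinearMap.lTensor T) θ) ∘ₗ
    (TensorProduct.assoc k T H H).symm.toLinearMap
  have hΨ : ∀ (t : T) (g h : H), Ψ (t ⊗ₜ (g ⊗ₜ h)) = (t ⊗ₜ (g ⊗ₜ 1)) * θ h :=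
    fun t g h => by simp [Ψ]
  have hΨm : ∀ (t : T) (g : H) (z : T ⊗[k] (H ⊗[k] H)),
      Ψ ((t ⊗ₜ (g ⊗ₜ 1)) * z) = (t ⊗ₜ (g ⊗ₜ 1)) * Ψ z := fun t g z => by
    induction z with
    | zero => simp
    | tmul a b =>
      induction b with
      | zero => simp
      | tmul c d =>
        rw [Algebra.TensorProduct.tmul_mul_tmul, Algebra.TensorProduct.tmul_mul_tmul, one_mul,
          hΨ, hΨ, ← mul_assoc, Algebra.TensorProduct.tmul_mul_tmul,
          Algebra.TensorProduct.tmul_mul_tmul, one_mul]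
      | add _ _ h₁ h₂ => simp only [TensorProduct.tmul_add, map_add, mul_add, h₁, h₂]
    | add _ _ h₁ h₂ => rw [mul_add, map_add, map_add, mul_add, h₁, h₂]
  have hFΨ : ∀ z, F (Ψ z) = z := fun z => by
    induction z with
    | zero => simp
    | tmul t b =>
      induction b with
      | zero => simp
      | tmul g h => rw [hΨ, hF, hFθ]; simp
      | add _ _ h₁ h₂ => simp only [TensorProduct.tmul_add, map_add, h₁, h₂]
    | add _ _ h₁ h₂ => simp only [map_add, h₁, h₂]
  have hΨA : ∀ (a : T) (z : T ⊗[k] (H ⊗[k] H)), Ψ (A₁ a * z) = A₁ a * Ψ z := fun a z => by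
    simp only [A₁, AlgHom.comp_apply]
    generalize δ a = w
    induction w with
    | zero => simp
    | tmul t g => simpa using hΨm t g z
    | add _ _ h₁ h₂ => simp only [map_add, add_mul, h₁, h₂]
  have hΨW : ∀ w, Ψ (W w) = Θ (e.symm w) := fun w => by
    induction w with
    | zero => simp
    | tmul t h =>
      rw [hW, hΨA, hΨ, ← Algebra.TensorProduct.one_def, ← Algebra.TensorProduct.one_def, one_mul,
        hθ, ← hΘs, ← map_smul, TensorProduct.smul_tmul', smul_eq_mul, mul_one]
    | add _ _ h₁ h₂ => simp only [map_add, h₁, h₂]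
  have hesymm : ∀ x, e.symm (δ x) = tmulB B 1 x := fun x => by
    rw [LinearEquiv.symm_apply_eq]
    change _ = galoisMap B δ hδ _
    rw [galoisMap_tmulB, one_smul]
  -- On δ(x), coassociativity turns T ⊗ Δ into W, and Ψ(W(δ(x))) = Θ(1 ⊗ x) is δ(x) with its H-part
  -- in the last factor. Left T-linearity and surjectivity of the Galois map do the rest.
  have hΨδ : ∀ w : T ⊗[k] H, Ψ ((comul (R := k) (A := H)).lTensor T w) =
      (TensorProduct.mk k H H 1).lTensor T w := fun w => by
    induction w using galois_induction hβ.2 with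
    | zero => simp
    | smul a x =>
      have h₁ : Ψ ((comul (R := k) (A := H)).lTensor T (δ x)) =
          (TensorProduct.mk k H H 1).lTensor T (δ x) := by
        rw [← hWδ, hΨW, hesymm, hΘ, map_one, one_mul]
        rfl
      rw [lTensor_smul, lTensor_smul, smul_eq_tmul_one_mul, smul_eq_tmul_one_mul,
        Algebra.TensorProduct.one_def, hΨm, h₁]
    | add _ _ h₁ h₂ => simp only [map_add, h₁, h₂]
  have hΨF : ∀ z, Ψ (F z) = z := fun z => by
    induction z with
    | zero => simp
    | tmul t b =>
      induction b with
      | zero => simp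
      | tmul g h =>
        have h₁ : F (t ⊗ₜ (g ⊗ₜ h)) =
            (t ⊗ₜ (g ⊗ₜ 1)) * (comul (R := k) (A := H)).lTensor T (1 ⊗ₜ h) := by
          simp [F, canonicalMap_tmul]
        rw [h₁, hΨm, hΨδ]
        simp
      | add _ _ h₁ h₂ => simp only [TensorProduct.tmul_add, map_add, h₁, h₂]
    | add _ _ h₁ h₂ => simp only [map_add, h₁, h₂]
  exact ⟨Function.LeftInverse.injective hΨF, Function.RightInverse.surjective hFΨ⟩

end Antipode

/-! ### Coalgebra axioms from the coaction -/

section Comodule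

variable {k : Type v} {T : Type u} [CommRing k] [Ring T] [Algebra k T] {B : Subalgebra k T}
  {H : Type w} [Ring H] [Algebra k H] {δ : T →ₐ[k] T ⊗[k] H}
  {hδ : ∀ b : B, δ (b : T) = (b : T) ⊗ₜ[k] (1 : H)}
  {Δ : H →ₗ[k] H ⊗[k] H} {ε : H →ₗ[k] k}

/-- Tested on δ(x), both sides become the threefold coaction (δ ⊗ H ⊗ H)(δ ⊗ H)δ(x). -/
theorem coassoc_of_galois [Module.FaithfullyFlat k T]
    (hβ : Function.Surjective (galoisMap B δ hδ))
    (hco : ∀ x : T, TensorProduct.assoc k T H H (δ.toLinearMap.rTensor H (δ x)) =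
      Δ.lTensor T (δ x)) :
    (TensorProduct.assoc k H H H).toLinearMap ∘ₗ Δ.rTensor H ∘ₗ Δ = Δ.lTensor H ∘ₗ Δ := by
  refine linearMap_ext_of_galois hβ fun x => ?_
  let A := (TensorProduct.assoc k T H H).toLinearMap
  have hco' : A ∘ₗ δ.toLinearMap.rTensor H ∘ₗ δ.toLinearMap = Δ.lTensor T ∘ₗ δ.toLinearMap :=
    LinearMap.ext hco
  let A' := (TensorProduct.assoc k H H H).toLinearMap
  let L := A'.lTensor T ∘ₗ (TensorProduct.assoc k T (H ⊗[k] H) H).toLinearMap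
  let M := (TensorProduct.assoc k T H (H ⊗[k] H)).toLinearMap
  -- Here `e₁`, `e₂`, `e₄` are naturality of the associator, `e₃` is the pentagon and `e₅` the
  -- interchange of δ with Δ.
  have e₁ : (A' ∘ₗ Δ.rTensor H).lTensor T ∘ₗ A = L ∘ₗ (Δ.lTensor T).rTensor H := by
    ext; simp [A, L]
  have e₂ : (Δ.lTensor H).lTensor T ∘ₗ A = M ∘ₗ Δ.lTensor (T ⊗[k] H) := by
    ext; simp [A, M]
  let N := (TensorProduct.assoc k (T ⊗[k] H) H H).toLinearMap
  have e₃ : L ∘ₗ A.rTensor H = M ∘ₗ N := by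
    ext; simp [L, M, N, A, A']
  have e₄ : N ∘ₗ (δ.toLinearMap.rTensor H).rTensor H =
      δ.toLinearMap.rTensor (H ⊗[k] H) ∘ₗ A := by
    ext t a b
    simp only [A, N, TensorProduct.AlgebraTensorModule.curry_apply, TensorProduct.curry_apply,
      LinearMap.restrictScalars_self, LinearMap.coe_comp, Function.comp_apply,
      LinearMap.rTensor_tmul, LinearEquiv.coe_coe, TensorProduct.assoc_tmul]
  have e₅ : δ.toLinearMap.rTensor (H ⊗[k] H) ∘ₗ Δ.lTensor T =
      Δ.lTensor (T ⊗[k] H) ∘ₗ δ.toLinearMap.rTensor H := by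
    rw [LinearMap.rTensor_comp_lTensor, LinearMap.lTensor_comp_rTensor]
  have hx : A (δ.toLinearMap.rTensor H (δ x)) = Δ.lTensor T (δ x) := hco x
  calc (A' ∘ₗ Δ.rTensor H ∘ₗ Δ).lTensor T (δ x)
      = (A' ∘ₗ Δ.rTensor H).lTensor T (Δ.lTensor T (δ x)) := by
        rw [← LinearMap.comp_apply, ← LinearMap.lTensor_comp]; rfl
    _ = L ((Δ.lTensor T ∘ₗ δ.toLinearMap).rTensor H (δ x)) := by
        rw [← hx, LinearMap.rTensor_comp]; exact LinearMap.congr_fun e₁ _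
    _ = (L ∘ₗ A.rTensor H) ((δ.toLinearMap.rTensor H).rTensor H
          (δ.toLinearMap.rTensor H (δ x))) := by
        rw [← hco', LinearMap.rTensor_comp, LinearMap.rTensor_comp]; rfl
    _ = M ((N ∘ₗ (δ.toLinearMap.rTensor H).rTensor H) (δ.toLinearMap.rTensor H (δ x))) := by
        rw [e₃]; rfl
    _ = M (δ.toLinearMap.rTensor (H ⊗[k] H) (Δ.lTensor T (δ x))) := by
        rw [e₄, ← hx]; rfl
    _ = M (Δ.lTensor (T ⊗[k] H) (δ.toLinearMap.rTensor H (δ x))) := by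
        congr 1; exact LinearMap.congr_fun e₅ _
    _ = (Δ.lTensor H).lTensor T (A (δ.toLinearMap.rTensor H (δ x))) := by
        exact (LinearMap.congr_fun e₂ _).symm
    _ = (Δ.lTensor H ∘ₗ Δ).lTensor T (δ x) := by
        rw [hx, LinearMap.lTensor_comp]; rfl

theorem rTensor_counit_of_galois [Module.FaithfullyFlat k T]
    (hβ : Function.Surjective (galoisMap B δ hδ))
    (hco : ∀ x : T, TensorProduct.assoc k T H H (δ.toLinearMap.rTensor H (δ x)) =
      Δ.lTensor T (δ x))
    (hε : ∀ x : T, ε.lTensor T (δ x) = x ⊗ₜ[k] (1 : k)) :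
    ε.rTensor H ∘ₗ Δ = (TensorProduct.lid k H).symm.toLinearMap := by
  refine linearMap_ext_of_galois hβ fun x => ?_
  rw [LinearMap.lTensor_comp, LinearMap.comp_apply, ← hco]
  generalize δ x = w
  induction w with
  | zero => simp
  | tmul t h =>
    have e : ∀ u : T ⊗[k] H, (ε.rTensor H).lTensor T (TensorProduct.assoc k T H H (u ⊗ₜ h)) =
        TensorProduct.assoc k T k H (ε.lTensor T u ⊗ₜ h) := fun u => by
      induction u with
      | zero => simp
      | tmul a b => simp
      | add _ _ h₁ h₂ => simp only [TensorProduct.add_tmul, map_add, h₁, h₂]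
    rw [LinearMap.rTensor_tmul, e, AlgHom.toLinearMap_apply, hε]
    simp
  | add _ _ h₁ h₂ => simp only [map_add, h₁, h₂]

theorem lTensor_counit_of_galois [Module.FaithfullyFlat k T]
    (hβ : Function.Surjective (galoisMap B δ hδ))
    (hco : ∀ x : T, TensorProduct.assoc k T H H (δ.toLinearMap.rTensor H (δ x)) =
      Δ.lTensor T (δ x))
    (hε : ∀ x : T, ε.lTensor T (δ x) = x ⊗ₜ[k] (1 : k)) :
    ε.lTensor H ∘ₗ Δ = (TensorProduct.rid k H).symm.toLinearMap := by
  refine linearMap_ext_of_galois hβ fun x => ?_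
  have e : ∀ w : T ⊗[k] H, (ε.lTensor H).lTensor T
      (TensorProduct.assoc k T H H (δ.toLinearMap.rTensor H w)) =
      TensorProduct.assoc k T H k (δ.toLinearMap.rTensor k (ε.lTensor T w)) := fun w => by
    induction w with
    | zero => simp
    | tmul t h =>
      simp only [LinearMap.rTensor_tmul, LinearMap.lTensor_tmul]
      generalize δ.toLinearMap t = u
      induction u with
      | zero => simp
      | tmul a b => simp
      | add _ _ h₁ h₂ => simp only [TensorProduct.add_tmul, map_add, h₁, h₂]
    | add _ _ h₁ h₂ => simp only [map_add, h₁, h₂]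
  rw [LinearMap.lTensor_comp, LinearMap.comp_apply, ← hco, e, hε, LinearMap.rTensor_tmul,
    AlgHom.toLinearMap_apply]
  generalize δ x = u
  induction u with
  | zero => simp
  | tmul a b => simp
  | add _ _ h₁ h₂ => simp only [TensorProduct.add_tmul, map_add, h₁, h₂]

/-- A comodule algebra that is faithfully flat over `k` and has a bijective Galois map determines
the structure of a Hopf algebra. -/
theorem isHopfGalois_of_galois [Module.FaithfullyFlat k T]
    (hβ : Function.Bijective (galoisMap B δ hδ)) (Δ : H →ₐ[k] H ⊗[k] H) (ε : H →ₐ[k] k)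
    (hco : ∀ x : T, TensorProduct.assoc k T H H (δ.toLinearMap.rTensor H (δ x)) =
      Δ.toLinearMap.lTensor T (δ x))
    (hε : ∀ x : T, ε.toLinearMap.lTensor T (δ x) = x ⊗ₜ[k] (1 : k))
    (hB : ∀ x : T, δ x = x ⊗ₜ[k] (1 : H) → x ∈ B) :
    ∃ (h₁ : (Algebra.TensorProduct.assoc k k k H H H).toAlgHom.comp
            ((Algebra.TensorProduct.map Δ (.id k H)).comp Δ) =
          (Algebra.TensorProduct.map (.id k H) Δ).comp Δ)
        (h₂ : (Algebra.TensorProduct.map ε (.id k H)).comp Δ =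
          (Algebra.TensorProduct.lid k H).symm.toAlgHom)
        (h₃ : (Algebra.TensorProduct.map (.id k H) ε).comp Δ =
          (Algebra.TensorProduct.rid k k H).symm.toAlgHom),
      (∃ hopf : HopfAlgebra k H, hopf.toBialgebra = Bialgebra.ofAlgHom Δ ε h₁ h₂ h₃) ∧
      letI : Bialgebra k H := Bialgebra.ofAlgHom Δ ε h₁ h₂ h₃
      IsHopfGalois B δ := by
  have h₁ : (Algebra.TensorProduct.assoc k k k H H H).toAlgHom.comp
      ((Algebra.TensorProduct.map Δ (.id k H)).comp Δ) =
        (Algebra.TensorProduct.map (.id k H) Δ).comp Δ :=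
    AlgHom.ext fun h => LinearMap.congr_fun (coassoc_of_galois hβ.2 hco) h
  have h₂ : (Algebra.TensorProduct.map ε (.id k H)).comp Δ =
      (Algebra.TensorProduct.lid k H).symm.toAlgHom :=
    AlgHom.ext fun h => LinearMap.congr_fun (rTensor_counit_of_galois hβ.2 hco hε) h
  have h₃ : (Algebra.TensorProduct.map (.id k H) ε).comp Δ =
      (Algebra.TensorProduct.rid k k H).symm.toAlgHom :=
    AlgHom.ext fun h => LinearMap.congr_fun (lTensor_counit_of_galois hβ.2 hco hε) h
  let _ : Bialgebra k H := Bialgebra.ofAlgHom Δ ε h₁ h₂ h₃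
  obtain ⟨S, hl, hr⟩ := exists_antipode_of_bijective (canonicalMap_bijective hβ hco)
  refine ⟨h₁, h₂, h₃, ⟨{ Bialgebra.ofAlgHom Δ ε h₁ h₂ h₃ with
      antipode := S
      mul_antipode_rTensor_comul := hl
      mul_antipode_lTensor_comul := hr }, rfl⟩, hco, hε, fun x => ⟨fun hx => hδ ⟨x, hx⟩, hB x⟩,
    (galoisMap B δ hδ).restrictScalars k, fun x y => ?_, hβ⟩
  rw [← smul_eq_tmul_one_mul]
  exact galoisMap_tmulB (hδ := hδ) B x y

end Comodule

/-! ### Flatness and descent along k → T and B ⊂ T -/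

section Flatness

variable {k : Type v} {T : Type u} [CommRing k] [Ring T] [Algebra k T]

/-- The sequence k → T → T ⊗ T given by x ↦ x ⊗ 1 - 1 ⊗ x becomes exact after T ⊗ -, where
multiplication provides a contraction; faithful flatness gives exactness before tensoring. -/
theorem mem_range_algebraMap_of_tmul_comm [Module.FaithfullyFlat k T] {x : T}
    (hx : x ⊗ₜ[k] (1 : T) = 1 ⊗ₜ x) : x ∈ LinearMap.range (Algebra.linearMap k T) := by
  let g : T →ₗ[k] T ⊗[k] T := (TensorProduct.mk k T T).flip 1 - TensorProduct.mk k T T 1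
  have hg : ∀ x, g x = x ⊗ₜ 1 - 1 ⊗ₜ x := fun _ => rfl
  have hex : Function.Exact ((Algebra.linearMap k T).lTensor T) (g.lTensor T) := by
    intro z
    constructor
    · intro hz
      let p : T ⊗[k] (T ⊗[k] T) →ₗ[k] T ⊗[k] T :=
        (LinearMap.mul' k T).rTensor T ∘ₗ (TensorProduct.assoc k T T T).symm.toLinearMap
      have hp : ∀ z, p (g.lTensor T z) = LinearMap.mul' k T z ⊗ₜ 1 - z := fun z => by
        induction z with
        | zero => simp
        | tmul a b => simp [hg, p, TensorProduct.tmul_sub]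
        | add _ _ h₁ h₂ => simp only [map_add, h₁, h₂, TensorProduct.add_tmul]; abel
      refine ⟨LinearMap.mul' k T z ⊗ₜ 1, ?_⟩
      have := hp z
      rw [hz, map_zero] at this
      simpa using sub_eq_zero.1 this.symm
    · rintro ⟨z, rfl⟩
      induction z with
      | zero => simp
      | tmul a r => simp [hg, Algebra.algebraMap_eq_smul_one]
      | add _ _ h₁ h₂ => simp only [map_add, h₁, h₂, add_zero]
  have := (Module.FaithfullyFlat.lTensor_exact_iff_exact k T (Algebra.linearMap k T) g).1 hex x
  exact this.1 (by rw [hg, hx, sub_self])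

theorem algebraMap_injective_of_faithfullyFlat [Module.FaithfullyFlat k T] :
    Function.Injective (algebraMap k T) := by
  rw [injective_iff_map_eq_zero]
  intro r hr
  apply one_tmul_injective (k := k) (T := T)
  apply (TensorProduct.rid k T).injective
  simpa [Algebra.algebraMap_eq_smul_one] using hr

/-- T ⊗ - reflects injectivity, and T ⊗ (H ⊗ f) is (T ⊗ H) ⊗ f up to associativity. -/
theorem flat_of_flat_tensor [Module.FaithfullyFlat k T] (H : Type w) [AddCommGroup H] [Module k H]
    [Module.Flat k (T ⊗[k] H)] : Module.Flat k H := by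
  rw [Module.Flat.iff_lTensor_preserves_injective_linearMap]
  intro N N' _ _ _ _ f hf
  rw [← Module.FaithfullyFlat.lTensor_injective_iff_injective k T]
  have h := Module.Flat.lTensor_preserves_injective_linearMap (M := T ⊗[k] H) f hf
  rw [LinearMap.lTensor_tensor] at h
  simpa using h

variable {B : Subalgebra k T}

theorem lTensorB_injective (hTB : IsFaithfullyFlatRight B) {M N : Type u} [AddCommGroup M]
    [AddCommGroup N] [Module k M] [Module k N] [Module B M] [Module B N]
    [IsScalarTower k B M] [IsScalarTower k B N] (f : M →ₗ[B] N) (hf : Function.Injective f) :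
    Function.Injective (lTensorB B f) := by
  -- Injectivity is encoded as exactness of M → M → N with zero first map.
  have h := (hTB M M N (0 : M →ₗ[B] M) f).1 fun x => by
    rw [map_eq_zero_iff f hf]
    exact ⟨fun h => ⟨0, h.symm⟩, fun ⟨_, h⟩ => h.symm⟩
  rw [injective_iff_map_eq_zero]
  intro z hz
  obtain ⟨y, rfl⟩ := (h z).1 hz
  clear hz
  induction y using balTensor_induction with
  | zero => simp
  | tmul x m =>
    rw [lTensorB_tmulB, LinearMap.zero_apply]
    exact map_zero (((balancedRel B M).mkQ.restrictScalars k) ∘ₗ TensorProduct.mk k T M x)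
  | add _ _ h₁ h₂ => rw [map_add, h₁, h₂, add_zero]

section Assoc

variable (B) (N : Type*) [AddCommGroup N] [Module k N]

/-- The map `(T ⊗_B T) ⊗ N → T ⊗_B (T ⊗ N)`. -/
def balAssoc : BalTensor B T ⊗[k] N →ₗ[k] BalTensor B (T ⊗[k] N) :=
  TensorProduct.lift ((liftB B (TensorProduct.curry (oneTmulB B (M := T ⊗[k] N)))
    fun b x => by
      ext n
      change oneTmulB B ((b • x) ⊗ₜ n) = (b : T) • oneTmulB B (x ⊗ₜ n)
      rw [← oneTmulB_smul]
      rfl).restrictScalars k)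

theorem balAssoc_tmul (x y : T) (n : N) :
    balAssoc B N (tmulB B x y ⊗ₜ n) = tmulB B x (y ⊗ₜ n) := by
  simp [balAssoc, smul_tmulB]

theorem balAssoc_injective : Function.Injective (balAssoc B N) := by
  let q : BalTensor B (T ⊗[k] N) →ₗ[T] BalTensor B T ⊗[k] N :=
    liftB B ((oneTmulB B).rTensor N) fun b z => by
      induction z with
      | zero => simp
      | tmul x n =>
        change (oneTmulB B).rTensor N ((b • x) ⊗ₜ n) = _
        rw [LinearMap.rTensor_tmul, LinearMap.rTensor_tmul, oneTmulB_smul,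
          TensorProduct.smul_tmul']
      | add _ _ h₁ h₂ => rw [smul_add, map_add, map_add, smul_add, h₁, h₂]
  refine Function.LeftInverse.injective (g := q) fun z => ?_
  induction z with
  | zero => simp
  | tmul s n =>
    induction s using balTensor_induction with
    | zero => simp
    | tmul x y =>
      rw [balAssoc_tmul, liftB_tmulB, LinearMap.rTensor_tmul, TensorProduct.smul_tmul',
        oneTmulB_apply, smul_tmulB, mul_one]
    | add _ _ h₁ h₂ => rw [TensorProduct.add_tmul, map_add, map_add, h₁, h₂]
  | add _ _ h₁ h₂ => rw [map_add, map_add, h₁, h₂]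

end Assoc

/-- For N → N' injective, T ⊗ N → T ⊗ N' is an injective B-linear map, and S ⊗ N embeds naturally in
T ⊗_B (T ⊗ N). -/
theorem flat_balTensor [Module.FaithfullyFlat k T] (hTB : IsFaithfullyFlatRight B) :
    Module.Flat k (BalTensor B T) := by
  -- The hypothesis on B concerns modules in the universe of T; since k embeds in T, flatness over k
  -- can be tested there.
  have : Small.{u} k := small_of_injective (algebraMap_injective_of_faithfullyFlat (k := k) (T := T))
  rw [Module.Flat.iff_lTensor_preserves_injective_linearMap'.{u, v, u}]
  intro N N' _ _ _ _ f hf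
  let F : T ⊗[k] N →ₗ[B] T ⊗[k] N' :=
    { toFun := f.lTensor T
      map_add' := map_add _
      map_smul' := fun b z => lTensor_smul f (b : T) z }
  have hF : Function.Injective F := Module.Flat.lTensor_preserves_injective_linearMap f hf
  have comm : ∀ z, lTensorB B F (balAssoc B N z) = balAssoc B N' (f.lTensor _ z) := fun z => by
    induction z with
    | zero => simp
    | tmul s n =>
      induction s using balTensor_induction with
      | zero => simp
      | tmul x y =>
        rw [balAssoc_tmul, lTensorB_tmulB, LinearMap.lTensor_tmul, balAssoc_tmul]
        rfl
      | add _ _ h₁ h₂ => rw [TensorProduct.add_tmul]; simp only [map_add, h₁, h₂]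
    | add _ _ h₁ h₂ => simp only [map_add, h₁, h₂]
  refine Function.Injective.of_comp (f := balAssoc B N') ?_
  have : balAssoc B N' ∘ f.lTensor _ = lTensorB B F ∘ balAssoc B N := funext fun z => (comm z).symm
  rw [this]
  exact (lTensorB_injective hTB F hF).comp (balAssoc_injective B N)

theorem tmulB_add_left {M : Type*} [AddCommGroup M] [Module k M] [Module B M] [IsScalarTower k B M]
    (x y : T) (m : M) : tmulB B (x + y) m = tmulB B x m + tmulB B y m := by
  simp only [tmulB, TensorProduct.add_tmul, map_add]

theorem tmulB_sub_right {M : Type*} [AddCommGroup M] [Module k M] [Module B M]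
    [IsScalarTower k B M] (x : T) (m n : M) :
    tmulB B x (m - n) = tmulB B x m - tmulB B x n := by
  simp only [tmulB, TensorProduct.tmul_sub, map_sub]

/-- The analogue over B of `mem_range_algebraMap_of_tmul_comm`: B → T → T ⊗_B T becomes exact after
T ⊗_B -, again contracted by multiplication. -/
theorem mem_of_tmulB_comm (hTB : IsFaithfullyFlatRight B) {x : T}
    (hx : tmulB B x 1 = tmulB B 1 x) : x ∈ B := by
  let f : B →ₗ[B] T :=
    { toFun := fun b => b
      map_add' := fun _ _ => rfl
      map_smul' := fun _ _ => rfl }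
  let g : T →ₗ[B] BalTensor B T :=
    { toFun := fun x => tmulB B x 1 - tmulB B 1 x
      map_add' := fun x y => by
        rw [tmulB_add_left, ← oneTmulB_apply, map_add]
        simp only [oneTmulB_apply]
        abel
      map_smul' := fun b x => by
        rw [RingHom.id_apply, smul_sub, ← oneTmulB_apply, oneTmulB_smul, oneTmulB_apply]
        congr 1 }
  have hg : ∀ x, g x = tmulB B x 1 - tmulB B 1 x := fun _ => rfl
  have hex : Function.Exact (lTensorB B f) (lTensorB B g) := by
    intro z
    constructor
    · intro hz
      let p : BalTensor B (BalTensor B T) →ₗ[T] BalTensor B T :=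
        liftB B LinearMap.id fun _ _ => rfl
      have hp : ∀ z, p (lTensorB B g z) = tmulB B (mulB B z) 1 - z := fun z => by
        induction z using balTensor_induction with
        | zero => simp [tmulB]
        | tmul x y =>
          rw [lTensorB_tmulB, liftB_tmulB, hg, LinearMap.id_apply, smul_sub, smul_tmulB,
            smul_tmulB, mul_one, mulB_tmulB]
        | add _ _ h₁ h₂ => simp only [map_add, h₁, h₂, tmulB_add_left]; abel
      have h := hp z
      rw [hz, map_zero] at h
      refine ⟨tmulB B (mulB B z) 1, ?_⟩
      rw [lTensorB_tmulB]
      exact sub_eq_zero.1 h.symm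
    · rintro ⟨z, rfl⟩
      induction z using balTensor_induction with
      | zero => simp
      | tmul y b =>
        rw [lTensorB_tmulB, lTensorB_tmulB, hg]
        have : tmulB B (f b) 1 = tmulB B 1 (f b) := by
          have h := tmulB_mul B (1 : T) b (1 : T)
          rwa [one_mul, Subalgebra.smul_def, smul_eq_mul, mul_one] at h
        rw [this, tmulB_sub_right, sub_self]
      | add _ _ h₁ h₂ => simp only [map_add, h₁, h₂, add_zero]
  obtain ⟨b, rfl⟩ := ((hTB B T (BalTensor B T) f g).2 hex x).1 (by rw [hg, hx, sub_self])
  exact b.2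

end Flatness

/-! ### The descent datum D, the algebra H and the coaction -/

namespace TorsorStructure

variable {k : Type v} {T : Type u} [CommRing k] [Ring T] [Algebra k T] {B : Subalgebra k T}
  (τ : TorsorStructure B)

theorem descentMap_tmulB (x y : T) : τ.descentMap (tmulB B x y) = x • muZero τ.mu y := by
  simp [descentMap]

theorem tensorMu_tmulB (x y : T) :
    tensorMu τ.mu τ.map_base (tmulB B x y) =
      x • (oneTmulB B).rTensor (BalTensor B T) (muZero τ.mu y) := by
  simp [tensorMu]

/-- The action `T ⊗ T ⊗_B T → T ⊗_B T`, `t ⊗ s ↦ t s`, is a left inverse of `D`. -/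
theorem lift_lsmul_descentMap (s : BalTensor B T) :
    TensorProduct.lift (Algebra.lsmul k k (BalTensor B T)).toLinearMap (τ.descentMap s) = s := by
  have key : ∀ (a : T) (z : T ⊗[k] BalTensor B T),
      TensorProduct.lift (Algebra.lsmul k k (BalTensor B T)).toLinearMap (a • z) =
        a • TensorProduct.lift (Algebra.lsmul k k (BalTensor B T)).toLinearMap z := fun a z => by
    induction z with
    | zero => simp
    | tmul x y => simp [TensorProduct.smul_tmul']
    | add _ _ h₁ h₂ => simp only [smul_add, map_add, h₁, h₂]
  induction s using balTensor_induction with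
  | zero => simp
  | tmul x y => rw [descentMap_tmulB, key, τ.mul_left, smul_tmulB, mul_one]
  | add _ _ h₁ h₂ => rw [map_add, map_add, h₁, h₂]

theorem descentMap_injective : Function.Injective τ.descentMap :=
  Function.LeftInverse.injective τ.lift_lsmul_descentMap

theorem rTensor_mulB_tensorMu (s : BalTensor B T) :
    ((mulB B).restrictScalars k).rTensor (BalTensor B T) (tensorMu τ.mu τ.map_base s) =
      τ.descentMap s := by
  induction s using balTensor_induction with
  | zero => simp
  | tmul x y =>
    rw [tensorMu_tmulB, descentMap_tmulB]
    generalize muZero τ.mu y = z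
    induction z with
    | zero => simp
    | tmul a b => simp [TensorProduct.smul_tmul', smul_tmulB]
    | add _ _ h₁ h₂ => simp only [smul_add, map_add, h₁, h₂]
  | add _ _ h₁ h₂ => rw [map_add, map_add, map_add, h₁, h₂]

/-- D is T ⊗_B μ₀ followed by multiplication S → T on the first factor S. Coassociativity moves the
second μ₀ to the first leg, where `mul_right` collapses it to x⁽¹⁾ ⊗ 1. -/
theorem lTensor_descentMap_muZero (x : T) :
    (τ.descentMap.restrictScalars k).lTensor T (muZero τ.mu x) =
      (TensorProduct.mk k T (BalTensor B T) 1).lTensor T (muZero τ.mu x) := by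
  have h : τ.descentMap.restrictScalars k =
      ((mulB B).restrictScalars k).rTensor (BalTensor B T) ∘ₗ
        (tensorMu τ.mu τ.map_base).restrictScalars k :=
    LinearMap.ext fun s => (τ.rTensor_mulB_tensorMu s).symm
  rw [h, LinearMap.lTensor_comp, LinearMap.comp_apply, ← τ.coassoc]
  generalize muZero τ.mu x = z
  induction z with
  | zero => simp
  | tmul t s =>
    have e : ∀ w : T ⊗[k] BalTensor B T,
        (((mulB B).restrictScalars k).rTensor (BalTensor B T)).lTensor T
          (TensorProduct.assoc k T (BalTensor B T) (BalTensor B T) (w ⊗ₜ s)) =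
        TensorProduct.assoc k T T (BalTensor B T)
          (((mulB B).restrictScalars k).lTensor T w ⊗ₜ s) := fun w => by
      induction w with
      | zero => simp
      | tmul a b => simp
      | add _ _ h₁ h₂ => simp only [TensorProduct.add_tmul, map_add, h₁, h₂]
    rw [LinearMap.rTensor_tmul, e, τ.mul_right]
    simp
  | add _ _ h₁ h₂ => simp only [map_add, h₁, h₂]

/-- The map `T ⊗_B T → T ⊗ (T ⊗_B T)^B`, `x ⊗ y ↦ x μ(y)`, through which `D` factors. -/
abbrev centralDescentMap : BalTensor B T →ₗ[T] T ⊗[k] centralizer B :=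
  galoisMap B τ.mu τ.map_base

theorem lTensor_centralDescentMap (s : BalTensor B T) :
    (centralizer B).subtype.lTensor T (τ.centralDescentMap s) = τ.descentMap s := by
  induction s using balTensor_induction with
  | zero => simp
  | tmul x y =>
    rw [galoisMap_tmulB, lTensor_smul, descentMap_tmulB]
    rfl
  | add _ _ h₁ h₂ => simp only [map_add, h₁, h₂]

theorem centralDescentMap_rightMulB (c : T) (s : BalTensor B T) :
    τ.centralDescentMap (rightMulB B c s) = τ.centralDescentMap s * τ.mu c := by
  induction s using balTensor_induction with
  | zero => simp
  | tmul x y =>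
    rw [rightMulB_tmulB, galoisMap_tmulB, galoisMap_tmulB, map_mul, smul_mul_tensor]
  | add _ _ h₁ h₂ => simp only [map_add, h₁, h₂, add_mul]

/-- Since μ(b) = b ⊗ 1 ⊗ 1, right multiplication by b only affects the first leg. The product with
μ(b) makes sense in T ⊗ S^B, hence the detour through `centralDescentMap`. -/
theorem descentMap_rightMulB (b : B) (s : BalTensor B T) :
    τ.descentMap (rightMulB B (b : T) s) =
      (LinearMap.mulRight k (b : T)).rTensor (BalTensor B T) (τ.descentMap s) := by
  rw [← lTensor_centralDescentMap, ← lTensor_centralDescentMap, centralDescentMap_rightMulB,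
    τ.map_base]
  generalize τ.centralDescentMap s = z
  induction z with
  | zero => simp
  | tmul t c => simp
  | add _ _ h₁ h₂ => simp only [map_add, h₁, h₂, add_mul]

/-- For D(m) = 1 ⊗ m, both D(bm) and D(mb) equal b ⊗ m, and D is injective. -/
theorem descentInvariants_le_centralizer : τ.descentInvariants ≤ centralizer B := by
  intro m hm b
  have hm' : τ.descentMap m = 1 ⊗ₜ m := hm
  apply τ.descentMap_injective
  rw [map_smul, descentMap_rightMulB, hm', LinearMap.rTensor_tmul, TensorProduct.smul_tmul']
  simp

theorem centralDescentMap_sandwich {h : centralizer B}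
    (hh : τ.centralDescentMap (h : BalTensor B T) = 1 ⊗ₜ h) (s : BalTensor B T) :
    τ.centralDescentMap (sandwich B h s) = (1 ⊗ₜ h) * τ.centralDescentMap s := by
  induction s using balTensor_induction with
  | zero => simp
  | tmul x y =>
    rw [sandwich_tmulB, map_smul, centralDescentMap_rightMulB, hh, galoisMap_tmulB,
      one_tmul_mul_smul]
  | add _ _ h₁ h₂ => simp only [map_add, h₁, h₂, mul_add]

/-- The algebra `H` of the elements `m` with `D(m) = 1 ⊗ m`, as a subalgebra of the
centralizer. -/
def hopfSubalgebra : Subalgebra k (centralizer B) where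
  carrier := {h | τ.centralDescentMap (h : BalTensor B T) = 1 ⊗ₜ h}
  mul_mem' {a b} ha hb := by
    change τ.centralDescentMap _ = _
    rw [coe_mul, τ.centralDescentMap_sandwich ha]
    rw [Set.mem_ofPred_eq] at hb
    rw [hb, Algebra.TensorProduct.tmul_mul_tmul, one_mul]
  add_mem' {a b} ha hb := by
    rw [Set.mem_ofPred_eq] at *
    rw [Submodule.coe_add, map_add, ha, hb, TensorProduct.tmul_add]
  algebraMap_mem' r := by
    rw [Set.mem_ofPred_eq, Algebra.algebraMap_eq_smul_one, Submodule.coe_smul, coe_one,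
      LinearMap.map_smul_of_tower, galoisMap_tmulB, map_one, one_smul, TensorProduct.tmul_smul,
      Algebra.TensorProduct.one_def]

/-- The inclusion of `H` in `T ⊗_B T`. -/
def incl : τ.hopfSubalgebra →ₗ[k] BalTensor B T :=
  (centralizer B).subtype ∘ₗ τ.hopfSubalgebra.val.toLinearMap

theorem incl_injective : Function.Injective τ.incl :=
  Subtype.val_injective.comp Subtype.val_injective

theorem descentMap_incl (h : τ.hopfSubalgebra) : τ.descentMap (τ.incl h) = 1 ⊗ₜ τ.incl h := by
  have hh : τ.centralDescentMap (τ.incl h) = 1 ⊗ₜ (h : centralizer B) := h.2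
  rw [← lTensor_centralDescentMap, hh]
  rfl

section Flat

variable [Module.Flat k T]

/-- `hopfSubalgebra` imposes its condition in T ⊗ S^B, where products exist; flatness of T embeds
this in T ⊗ S, where D takes its values. -/
theorem map_hopfSubalgebra :
    (Subalgebra.toSubmodule τ.hopfSubalgebra).map (centralizer B).subtype =
      τ.descentInvariants := by
  apply le_antisymm
  · rintro _ ⟨h, hh, rfl⟩
    exact τ.descentMap_incl ⟨h, hh⟩
  · intro m hm
    refine ⟨⟨m, τ.descentInvariants_le_centralizer hm⟩, ?_, rfl⟩
    change τ.centralDescentMap m = _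
    apply Module.Flat.lTensor_preserves_injective_linearMap (M := T) (centralizer B).subtype
      Subtype.val_injective
    rw [lTensor_centralDescentMap]
    exact hm

theorem exact_incl : Function.Exact τ.incl
    (τ.descentMap.restrictScalars k - TensorProduct.mk k T (BalTensor B T) 1) := by
  intro m
  rw [LinearMap.sub_apply, sub_eq_zero]
  constructor
  · intro hm
    have : m ∈ τ.descentInvariants := hm
    rw [← map_hopfSubalgebra] at this
    obtain ⟨h, hh, rfl⟩ := this
    exact ⟨⟨h, hh⟩, rfl⟩
  · rintro ⟨h, rfl⟩
    exact τ.descentMap_incl h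

/-- The inclusion of `T ⊗ H` in `T ⊗ (T ⊗_B T)^B`. -/
def tensorIncl : T ⊗[k] τ.hopfSubalgebra →ₐ[k] T ⊗[k] centralizer B :=
  Algebra.TensorProduct.map (.id k T) τ.hopfSubalgebra.val

theorem tensorIncl_apply (z : T ⊗[k] τ.hopfSubalgebra) :
    τ.tensorIncl z = τ.hopfSubalgebra.val.toLinearMap.lTensor T z := rfl

theorem tensorIncl_injective : Function.Injective τ.tensorIncl :=
  Module.Flat.lTensor_preserves_injective_linearMap (M := T) τ.hopfSubalgebra.val.toLinearMap
    Subtype.val_injective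

theorem lTensor_incl_injective : Function.Injective (τ.incl.lTensor T) :=
  Module.Flat.lTensor_preserves_injective_linearMap (M := T) τ.incl τ.incl_injective

theorem mu_mem_range (x : T) : τ.mu x ∈ τ.tensorIncl.range := by
  obtain ⟨w, hw⟩ := (Module.Flat.lTensor_exact T τ.exact_incl (muZero τ.mu x)).1 (by
    rw [LinearMap.lTensor_sub, LinearMap.sub_apply, τ.lTensor_descentMap_muZero, sub_self])
  refine ⟨w, ?_⟩
  apply Module.Flat.lTensor_preserves_injective_linearMap (M := T) (centralizer B).subtype
    Subtype.val_injective
  change _ = muZero τ.mu x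
  rw [← hw, incl, LinearMap.lTensor_comp]
  rfl

/-- The coaction `δ : T → T ⊗ H` that induces `μ`. -/
noncomputable def coaction : T →ₐ[k] T ⊗[k] τ.hopfSubalgebra :=
  (AlgEquiv.ofInjective τ.tensorIncl τ.tensorIncl_injective).symm.toAlgHom.comp
    (τ.mu.codRestrict τ.tensorIncl.range τ.mu_mem_range)

theorem tensorIncl_coaction (x : T) : τ.tensorIncl (τ.coaction x) = τ.mu x :=
  congrArg Subtype.val ((AlgEquiv.ofInjective τ.tensorIncl τ.tensorIncl_injective).apply_symm_apply
    (τ.mu.codRestrict τ.tensorIncl.range τ.mu_mem_range x))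

theorem lTensor_incl_coaction (x : T) : τ.incl.lTensor T (τ.coaction x) = muZero τ.mu x := by
  rw [incl, LinearMap.lTensor_comp, LinearMap.comp_apply, ← tensorIncl_apply, tensorIncl_coaction]
  rfl

theorem coaction_base (b : B) : τ.coaction (b : T) = (b : T) ⊗ₜ[k] 1 := by
  apply τ.tensorIncl_injective
  rw [tensorIncl_coaction, τ.map_base, tensorIncl_apply]
  rfl

theorem lTensor_incl_galoisMap (s : BalTensor B T) :
    τ.incl.lTensor T (galoisMap B τ.coaction τ.coaction_base s) = τ.descentMap s := by
  induction s using balTensor_induction with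
  | zero => simp
  | tmul x y => rw [galoisMap_tmulB, lTensor_smul, lTensor_incl_coaction, descentMap_tmulB]
  | add _ _ h₁ h₂ => simp only [map_add, h₁, h₂]

theorem galoisMap_bijective :
    Function.Bijective (galoisMap B τ.coaction τ.coaction_base) := by
  constructor
  · intro s t hst
    apply τ.descentMap_injective
    rw [← lTensor_incl_galoisMap, hst, lTensor_incl_galoisMap]
  · intro w
    induction w with
    | zero => exact ⟨0, map_zero _⟩
    | tmul t h =>
      refine ⟨t • τ.incl h, τ.lTensor_incl_injective ?_⟩
      rw [lTensor_incl_galoisMap, map_smul, descentMap_incl, TensorProduct.smul_tmul',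
        LinearMap.lTensor_tmul, smul_eq_mul, mul_one]
    | add _ _ h₁ h₂ =>
      obtain ⟨s, rfl⟩ := h₁
      obtain ⟨t, rfl⟩ := h₂
      exact ⟨s + t, map_add _ _ _⟩

/-- This extends the coassociativity of μ from T to S by left T-linearity; it is what keeps Δ inside
H ⊗ H. -/
theorem rTensor_descentMap_tensorMu (s : BalTensor B T) :
    TensorProduct.assoc k T (BalTensor B T) (BalTensor B T)
        ((τ.descentMap.restrictScalars k).rTensor (BalTensor B T)
          (tensorMu τ.mu τ.map_base s)) =
      ((tensorMu τ.mu τ.map_base).restrictScalars k).lTensor T (τ.descentMap s) := by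
  induction s using balTensor_induction with
  | zero => simp
  | tmul x y =>
    rw [tensorMu_tmulB, descentMap_tmulB, lTensor_smul, ← τ.coassoc]
    generalize muZero τ.mu y = z
    induction z with
    | zero => simp
    | tmul t s =>
      have e : ∀ w : T ⊗[k] BalTensor B T,
          TensorProduct.assoc k T (BalTensor B T) (BalTensor B T) ((x • w) ⊗ₜ s) =
            x • TensorProduct.assoc k T (BalTensor B T) (BalTensor B T) (w ⊗ₜ s) := fun w => by
        induction w with
        | zero => simp
        | tmul a b => simp [TensorProduct.smul_tmul']
        | add _ _ h₁ h₂ => simp only [smul_add, TensorProduct.add_tmul, map_add, h₁, h₂]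
      rw [LinearMap.rTensor_tmul, TensorProduct.smul_tmul', LinearMap.rTensor_tmul,
        LinearMap.rTensor_tmul, ← e, oneTmulB_apply, smul_tmulB, mul_one]
      congr 2
    | add _ _ h₁ h₂ => simp only [smul_add, map_add, h₁, h₂]
  | add _ _ h₁ h₂ => simp only [map_add, h₁, h₂]

end Flat

end TorsorStructure

/-! ### Transport of coactions along injective maps -/

section TensorCoaction

variable {k : Type v} {T : Type u} [CommRing k] [Ring T] [Algebra k T] (B : Subalgebra k T)
  {H : Type w} [Ring H] [Algebra k H] (δ : T →ₐ[k] T ⊗[k] H)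

/-- The map `T ⊗_B δ : T ⊗_B T → (T ⊗_B T) ⊗ H`. -/
def tensorCoaction (hδ : ∀ b : B, δ (b : T) = (b : T) ⊗ₜ[k] (1 : H)) :
    BalTensor B T →ₗ[T] BalTensor B T ⊗[k] H :=
  liftB B ((oneTmulB B).rTensor H ∘ₗ δ.toLinearMap) fun b x => by
    rw [LinearMap.comp_apply, LinearMap.comp_apply, Subalgebra.smul_def, smul_eq_mul,
      AlgHom.toLinearMap_apply, AlgHom.toLinearMap_apply, map_mul, hδ, ← smul_eq_tmul_one_mul]
    generalize δ x = z
    induction z with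
    | zero => simp
    | tmul a t =>
      rw [TensorProduct.smul_tmul', LinearMap.rTensor_tmul, LinearMap.rTensor_tmul,
        TensorProduct.smul_tmul', ← oneTmulB_smul]
      rfl
    | add _ _ h₁ h₂ => rw [smul_add, map_add, map_add, smul_add, h₁, h₂]

theorem tensorCoaction_tmulB (hδ : ∀ b : B, δ (b : T) = (b : T) ⊗ₜ[k] (1 : H)) (x y : T) :
    tensorCoaction B δ hδ (tmulB B x y) = x • (oneTmulB B).rTensor H (δ y) := by
  simp [tensorCoaction]

theorem lTensor_map_assoc_rTensor {M N : Type*} [AddCommGroup M] [Module k M] [AddCommGroup N]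
    [Module k N] (j : M →ₗ[k] N) (f : T →ₗ[k] T ⊗[k] M) (z : T ⊗[k] M) :
    (TensorProduct.map j j).lTensor T (TensorProduct.assoc k T M M (f.rTensor M z)) =
      TensorProduct.assoc k T N N ((j.lTensor T ∘ₗ f).rTensor N (j.lTensor T z)) := by
  induction z with
  | zero => simp
  | tmul t a =>
    rw [LinearMap.lTensor_tmul, LinearMap.rTensor_tmul, LinearMap.rTensor_tmul,
      LinearMap.comp_apply]
    generalize f t = w
    induction w with
    | zero => simp
    | tmul p q => simp
    | add _ _ h₁ h₂ => simp only [TensorProduct.add_tmul, map_add, h₁, h₂]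
  | add _ _ h₁ h₂ => simp only [map_add, h₁, h₂]

theorem lTensor_smul_rTensor {M N P : Type*} [AddCommGroup M] [Module k M] [AddCommGroup N]
    [Module k N] [AddCommGroup P] [Module k P] [Module T P] [IsScalarTower k T P]
    (j : M →ₗ[k] N) (f : T →ₗ[k] P) (x : T) (z : T ⊗[k] M) :
    j.lTensor P (x • f.rTensor M z) = x • f.rTensor N (j.lTensor T z) := by
  induction z with
  | zero => simp
  | tmul a t => simp [TensorProduct.smul_tmul']
  | add _ _ h₁ h₂ => simp only [smul_add, map_add, h₁, h₂]

theorem assoc_rTensor_eq_of_injective [Module.Flat k T] {M N : Type*} [AddCommGroup M] [Module k M]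
    [AddCommGroup N] [Module k N] {j : M →ₗ[k] N} (hj : Function.Injective (TensorProduct.map j j))
    {f : T →ₗ[k] T ⊗[k] M} {g : T →ₗ[k] T ⊗[k] N} (hfg : j.lTensor T ∘ₗ f = g)
    {d : M →ₗ[k] M ⊗[k] M} {e : N →ₗ[k] N ⊗[k] N} (hde : TensorProduct.map j j ∘ₗ d = e ∘ₗ j)
    {x : T} (hx : TensorProduct.assoc k T N N (g.rTensor N (g x)) = e.lTensor T (g x)) :
    TensorProduct.assoc k T M M (f.rTensor M (f x)) = d.lTensor T (f x) := by
  apply Module.Flat.lTensor_preserves_injective_linearMap (M := T) _ hj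
  have hfx : j.lTensor T (f x) = g x := LinearMap.congr_fun hfg x
  have h : (TensorProduct.map j j).lTensor T (d.lTensor T (f x)) =
      e.lTensor T (j.lTensor T (f x)) := by
    rw [← LinearMap.comp_apply, ← LinearMap.lTensor_comp, hde, LinearMap.lTensor_comp,
      LinearMap.comp_apply]
  rw [h, lTensor_map_assoc_rTensor, hfg, hfx, hx]

/-- Flatness of M preserves the equalizer of f and g under - ⊗ M, and flatness of P allows the
remaining equality to be checked in P ⊗ N instead of P ⊗ M. -/
theorem mem_range_rTensor_of_exact {M N P : Type*} [AddCommGroup M] [Module k M] [AddCommGroup N]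
    [Module k N] [AddCommGroup P] [Module k P] [Module.Flat k M] [Module.Flat k P]
    {j : M →ₗ[k] N} (hj : Function.Injective j) {f g : N →ₗ[k] P} (hex : Function.Exact j (f - g))
    {z : N ⊗[k] M} (hz : f.rTensor N (j.lTensor N z) = g.rTensor N (j.lTensor N z)) :
    z ∈ LinearMap.range (j.rTensor M) := by
  apply (Module.Flat.rTensor_exact M hex _).1
  apply Module.Flat.lTensor_preserves_injective_linearMap (M := P) j hj
  rw [map_zero, ← LinearMap.comp_apply, LinearMap.lTensor_comp_rTensor,
    ← LinearMap.rTensor_comp_lTensor, LinearMap.comp_apply, LinearMap.rTensor_sub,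
    LinearMap.sub_apply, hz, sub_self]

theorem assoc_rTensor_mk_one {M N : Type*} [AddCommGroup M] [Module k M] [AddCommGroup N]
    [Module k N] (z : M ⊗[k] N) :
    TensorProduct.assoc k T M N ((TensorProduct.mk k T M 1).rTensor N z) = 1 ⊗ₜ z := by
  induction z with
  | zero => simp
  | tmul s t => simp
  | add _ _ h₁ h₂ => rw [TensorProduct.tmul_add, map_add, map_add, h₁, h₂]

end TensorCoaction

/-! ### The Hopf algebra structure of H -/

namespace TorsorStructure

variable {k : Type v} {T : Type u} [CommRing k] [Ring T] [Algebra k T] {B : Subalgebra k T}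
  (τ : TorsorStructure B)

section Flat

variable [Module.Flat k T]

/-- The map `T ⊗_B δ : T ⊗_B T → (T ⊗_B T) ⊗ H`. -/
noncomputable abbrev tensorDelta : BalTensor B T →ₗ[T] BalTensor B T ⊗[k] τ.hopfSubalgebra :=
  tensorCoaction B τ.coaction τ.coaction_base

theorem lTensor_incl_tensorDelta (s : BalTensor B T) :
    τ.incl.lTensor (BalTensor B T) (τ.tensorDelta s) = tensorMu τ.mu τ.map_base s := by
  induction s using balTensor_induction with
  | zero => simp
  | tmul x y =>
    rw [tensorMu_tmulB, ← lTensor_incl_coaction, tensorCoaction_tmulB, lTensor_smul_rTensor]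
  | add _ _ h₁ h₂ => simp only [map_add, h₁, h₂]

end Flat

variable [Module.FaithfullyFlat k T]

theorem flat_hopfSubalgebra (hTB : IsFaithfullyFlatRight B) :
    Module.Flat k τ.hopfSubalgebra := by
  have := flat_balTensor hTB
  let e : BalTensor B T ≃ₗ[k] T ⊗[k] τ.hopfSubalgebra := LinearEquiv.ofBijective
    ((galoisMap B τ.coaction τ.coaction_base).restrictScalars k) τ.galoisMap_bijective
  have : Module.Flat k (T ⊗[k] τ.hopfSubalgebra) := Module.Flat.of_linearEquiv e.symm
  exact flat_of_flat_tensor (T := T) τ.hopfSubalgebra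

/-- By `mul_right`, T ⊗ mult sends D(s) to mult(s) ⊗ 1; for s = h in H it also gives 1 ⊗ mult(h). -/
theorem mulB_incl_mem_range (h : τ.hopfSubalgebra) :
    mulB B (τ.incl h) ∈ LinearMap.range (Algebra.linearMap k T) := by
  apply mem_range_algebraMap_of_tmul_comm
  have key : ∀ s : BalTensor B T,
      ((mulB B).restrictScalars k).lTensor T (τ.descentMap s) = mulB B s ⊗ₜ[k] (1 : T) := fun s => by
    induction s using balTensor_induction with
    | zero => simp
    | tmul x y =>
      rw [descentMap_tmulB, lTensor_smul, τ.mul_right, TensorProduct.smul_tmul', mulB_tmulB,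
        smul_eq_mul]
    | add _ _ h₁ h₂ => simp only [map_add, h₁, h₂, TensorProduct.add_tmul]
  rw [← key, descentMap_incl]
  rfl

/-- The counit of `H`, `ε(x ⊗ y) = x y`. -/
noncomputable def counit : τ.hopfSubalgebra →ₗ[k] k :=
  (LinearEquiv.ofInjective (Algebra.linearMap k T)
    algebraMap_injective_of_faithfullyFlat).symm.toLinearMap ∘ₗ
  ((mulB B).restrictScalars k ∘ₗ τ.incl).codRestrict _ τ.mulB_incl_mem_range

theorem algebraMap_counit (h : τ.hopfSubalgebra) :
    algebraMap k T (τ.counit h) = mulB B (τ.incl h) :=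
  congrArg Subtype.val ((LinearEquiv.ofInjective (Algebra.linearMap k T)
    algebraMap_injective_of_faithfullyFlat).apply_symm_apply
      (((mulB B).restrictScalars k ∘ₗ τ.incl).codRestrict _ τ.mulB_incl_mem_range h))

theorem lTensor_counit_coaction (x : T) :
    τ.counit.lTensor T (τ.coaction x) = x ⊗ₜ[k] (1 : k) := by
  apply Module.Flat.lTensor_preserves_injective_linearMap (M := T) (Algebra.linearMap k T)
    algebraMap_injective_of_faithfullyFlat
  have h : Algebra.linearMap k T ∘ₗ τ.counit = (mulB B).restrictScalars k ∘ₗ τ.incl :=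
    LinearMap.ext τ.algebraMap_counit
  rw [← LinearMap.comp_apply, ← LinearMap.lTensor_comp, h, LinearMap.lTensor_comp,
    LinearMap.comp_apply, lTensor_incl_coaction, τ.mul_right, LinearMap.lTensor_tmul,
    Algebra.linearMap_apply, map_one]

variable [Module.Flat k (BalTensor B T)] [Module.Flat k τ.hopfSubalgebra]

theorem tensorDelta_incl_mem_range (h : τ.hopfSubalgebra) :
    τ.tensorDelta (τ.incl h) ∈ LinearMap.range (τ.incl.rTensor τ.hopfSubalgebra) := by
  apply mem_range_rTensor_of_exact τ.incl_injective τ.exact_incl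
  rw [lTensor_incl_tensorDelta]
  apply (TensorProduct.assoc k T (BalTensor B T) (BalTensor B T)).injective
  rw [rTensor_descentMap_tensorMu, descentMap_incl, assoc_rTensor_mk_one]
  rfl

theorem rTensor_incl_injective : Function.Injective (τ.incl.rTensor τ.hopfSubalgebra) :=
  Module.Flat.rTensor_preserves_injective_linearMap τ.incl τ.incl_injective

/-- The comultiplication of `H`, `Δ(x ⊗ y) = x ⊗ y⁽¹⁾ ⊗ y⁽²⁾ ⊗ y⁽³⁾`. -/
noncomputable def comul : τ.hopfSubalgebra →ₗ[k] τ.hopfSubalgebra ⊗[k] τ.hopfSubalgebra :=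
  (LinearEquiv.ofInjective _ τ.rTensor_incl_injective).symm.toLinearMap ∘ₗ
  (τ.tensorDelta.restrictScalars k ∘ₗ τ.incl).codRestrict _ τ.tensorDelta_incl_mem_range

theorem rTensor_incl_comul (h : τ.hopfSubalgebra) :
    τ.incl.rTensor τ.hopfSubalgebra (τ.comul h) = τ.tensorDelta (τ.incl h) :=
  congrArg Subtype.val ((LinearEquiv.ofInjective _ τ.rTensor_incl_injective).apply_symm_apply
    ((τ.tensorDelta.restrictScalars k ∘ₗ τ.incl).codRestrict _
      τ.tensorDelta_incl_mem_range h))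

theorem map_incl_comul (h : τ.hopfSubalgebra) :
    TensorProduct.map τ.incl τ.incl (τ.comul h) = tensorMu τ.mu τ.map_base (τ.incl h) := by
  rw [← LinearMap.lTensor_comp_rTensor, LinearMap.comp_apply, rTensor_incl_comul,
    lTensor_incl_tensorDelta]

theorem map_incl_injective : Function.Injective (TensorProduct.map τ.incl τ.incl) := by
  rw [← LinearMap.lTensor_comp_rTensor]
  exact (Module.Flat.lTensor_preserves_injective_linearMap (M := BalTensor B T) τ.incl
    τ.incl_injective).comp τ.rTensor_incl_injective

/-- The torsor axiom is this identity after the embedding of T ⊗ H ⊗ H in T ⊗ S ⊗ S. -/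
theorem coaction_coassoc (x : T) :
    TensorProduct.assoc k T τ.hopfSubalgebra τ.hopfSubalgebra
        (τ.coaction.toLinearMap.rTensor τ.hopfSubalgebra (τ.coaction x)) =
      τ.comul.lTensor T (τ.coaction x) :=
  assoc_rTensor_eq_of_injective τ.map_incl_injective (LinearMap.ext τ.lTensor_incl_coaction)
    (e := (tensorMu τ.mu τ.map_base).restrictScalars k) (LinearMap.ext τ.map_incl_comul)
    (τ.coassoc x)

/-- The comultiplication of `H` as an algebra map. -/
noncomputable def comulAlgHom :
    τ.hopfSubalgebra →ₐ[k] τ.hopfSubalgebra ⊗[k] τ.hopfSubalgebra :=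
  algHomOfGalois τ.galoisMap_bijective.2 τ.comul
    ((Algebra.TensorProduct.assoc k k k T τ.hopfSubalgebra τ.hopfSubalgebra).toAlgHom.comp
      ((Algebra.TensorProduct.map τ.coaction (.id k τ.hopfSubalgebra)).comp τ.coaction))
    fun x => (τ.coaction_coassoc x).symm

/-- The counit of `H` as an algebra map. -/
noncomputable def counitAlgHom : τ.hopfSubalgebra →ₐ[k] k :=
  algHomOfGalois τ.galoisMap_bijective.2 τ.counit Algebra.TensorProduct.includeLeft
    τ.lTensor_counit_coaction

theorem mem_of_coaction_eq (hTB : IsFaithfullyFlatRight B) {x : T}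
    (hx : τ.coaction x = x ⊗ₜ[k] 1) : x ∈ B := by
  apply mem_of_tmulB_comm hTB
  have h : muZero τ.mu x = x ⊗ₜ tmulB B 1 1 := by
    rw [← τ.lTensor_incl_coaction, hx]
    rfl
  -- With μ₀(x) = x ⊗ 1 ⊗ 1, this axiom reads x ⊗ 1 = 1 ⊗ x in S.
  have h' := τ.mul_left x
  rw [h] at h'
  simpa [smul_tmulB] using h'

end TorsorStructure

end NoncommTorsor

theorem mainTheorem3 {k : Type*} {T : Type*} [CommRing k] [Ring T] [Algebra k T]
    (B : Subalgebra k T) (hTk : Module.FaithfullyFlat k T)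
    (hTB : NoncommTorsor.IsFaithfullyFlatRight B) (τ : NoncommTorsor.TorsorStructure B) :
    ∃ H : Subalgebra k (NoncommTorsor.centralizer B),
      (Subalgebra.toSubmodule H).map (NoncommTorsor.centralizer B).subtype =
          τ.descentInvariants ∧
      Module.Flat k H ∧
      ∃ (Δ : H →ₐ[k] H ⊗[k] H) (ε : H →ₐ[k] k)
        (h₁ : (Algebra.TensorProduct.assoc k k k H H H).toAlgHom.comp
            ((Algebra.TensorProduct.map Δ (.id k H)).comp Δ) =
          (Algebra.TensorProduct.map (.id k H) Δ).comp Δ)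
        (h₂ : (Algebra.TensorProduct.map ε (.id k H)).comp Δ =
          (Algebra.TensorProduct.lid k H).symm.toAlgHom)
        (h₃ : (Algebra.TensorProduct.map (.id k H) ε).comp Δ =
          (Algebra.TensorProduct.rid k k H).symm.toAlgHom),
        (∀ h : H,
          TensorProduct.map ((NoncommTorsor.centralizer B).subtype ∘ₗ H.val.toLinearMap)
              ((NoncommTorsor.centralizer B).subtype ∘ₗ H.val.toLinearMap) (Δ h) =
            NoncommTorsor.tensorMu τ.mu τ.map_base
              ((h : NoncommTorsor.centralizer B) : NoncommTorsor.BalTensor B T)) ∧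
        (∀ h : H, algebraMap k T (ε h) =
          NoncommTorsor.mulB B
            ((h : NoncommTorsor.centralizer B) : NoncommTorsor.BalTensor B T)) ∧
        (∃ hopf : HopfAlgebra k H, hopf.toBialgebra = Bialgebra.ofAlgHom Δ ε h₁ h₂ h₃) ∧
        ∃ δ : T →ₐ[k] T ⊗[k] H,
          (∀ x : T, H.val.toLinearMap.lTensor T (δ x) = τ.mu x) ∧
          letI : Bialgebra k H := Bialgebra.ofAlgHom Δ ε h₁ h₂ h₃
          NoncommTorsor.IsHopfGalois B δ := by
  have hS : Module.Flat k (NoncommTorsor.BalTensor B T) := NoncommTorsor.flat_balTensor hTB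
  have hH : Module.Flat k τ.hopfSubalgebra := τ.flat_hopfSubalgebra hTB
  have H₀ := NoncommTorsor.isHopfGalois_of_galois τ.galoisMap_bijective τ.comulAlgHom
    τ.counitAlgHom τ.coaction_coassoc τ.lTensor_counit_coaction fun x => τ.mem_of_coaction_eq hTB
  obtain ⟨h₁, H₀⟩ := H₀
  obtain ⟨h₂, H₀⟩ := H₀
  obtain ⟨h₃, H₀⟩ := H₀
  obtain ⟨hopf, hgal⟩ := H₀
  exact ⟨τ.hopfSubalgebra, τ.map_hopfSubalgebra, hH, τ.comulAlgHom, τ.counitAlgHom, h₁, h₂, h₃,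
    τ.map_incl_comul, τ.algebraMap_counit, hopf, τ.coaction, τ.tensorIncl_coaction, hgal⟩
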